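/- **Setting.** Let $m\ge 1$. An operator space is a complex vector space $V$ with norms on all $M_n(V)$ satisfying Ruan's axioms (completeness is not assumed). A *matrix ordered operator space* is an operator space $V$ with a conjugate-linear involution and, for each $n$, a cone $M_n(V)^+\subseteq M_n(V)_{sa}$, such that $A^*M_n(V)^+A\subseteq M_k(V)^+$ for all $A\in M_{n,k}$, the involution is isometric on each $M_n(V)$, and each $M_n(V)^+$ is norm closed. It is *matrix regular* if for all $n\ge 1$ and $v\in M_n(V)_{sa}$: (1) $u\in M_n(V)^+$ and $-u\le v\le u$ imply $\|v\|_n\le\|u\|_n$; (2) $\|v\|_n\le 1$ implies that there is $u\in M_n(V)^+$ with $\|u\|_n\le 1$ and $-u\le v\le u$. Let $\lambda=(\lambda_k)_{k\ge1}$ be a sequence of $m$-linear maps $\lambda_k:M_k\times\cdots\times M_k\to M_{\tau(k)}$ over complex matrices. Write $\varepsilon^{[k]}_{i,j}$ for the matrix units of $M_k$ (set to $0$ if $i$ or $j$ is not in $\{1,\dots,k\}$), and consider the following conditions. * (E1) For every $k$ there are $p\in\mathbb N$, $S\in M_{k,\tau(p)}$, $T\in M_{\tau(p),k}$ and $a_1,\dots,a_k\in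 M_p$ such that $S\lambda_p(a_{j_1},\dots,a_{j_m})T$ equals $\varepsilon^{[k]}_{j,j}$ if $j_1=\dots=j_m=j$ and equals $0$ otherwise. * (E2) For all $r,s$ there is $P\in M_{\tau(r)+\tau(s),\tau(r+s)}$ with $\|P\|\le1$ such that $$P\lambda_{r+s}(\varepsilon^{[r+s]}_{i_1,j_1},\dots,\varepsilon^{[r+s]}_{i_m,j_m})P^*=\begin{pmatrix}\lambda_r(\varepsilon^{[r]}_{i_1,j_1},\dots,\varepsilon^{[r]}_{i_m,j_m})&0\\0&\lambda_s(\varepsilon^{[s]}_{i_1-r,j_1-r},\dots,\varepsilon^{[s]}_{i_m-r,j_m-r})\end{pmatrix}$$ whenever all $(i_t,j_t)\in\{1,\dots,r\}^2\cup\{r+1,\dots,r+s\}^2$. * (E3) $\lambda_1(1,\dots,1)=1$ and $\sup_k\|\lambda_k\|<\infty$. * (O1) $\lambda_r(\varepsilon^{[r]}_{i_1,j_1},\dots,\varepsilon^{[r]}_{i_m,j_m})=\lambda_r(\varepsilon^{[r]}_{j_1,i_1},\dots,\varepsilon^{[r]}_{j_m,i_m})^*$ for all $r$ and all indices. * (O2)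 For every $r$ the matrix $P$ in (E2) for $s=r$ can be chosen such that moreover $$P\lambda_{2r}(\varepsilon^{[2r]}_{i_1,j_1},\dots,\varepsilon^{[2r]}_{i_m,j_m})P^*=\begin{pmatrix}0&\lambda_r(\varepsilon^{[r]}_{i_1,j_1-r},\dots,\varepsilon^{[r]}_{i_m,j_m-r})\\ \lambda_r(\varepsilon^{[r]}_{i_1-r,j_1},\dots,\varepsilon^{[r]}_{i_m-r,j_m})&0\end{pmatrix}$$ whenever all $(i_t,j_t)\in\{1,\dots,r\}\times\{r+1,\dots,2r\}\,\cup\,\{r+1,\dots,2r\}\times\{1,\dots,r\}$. * (O3) For all $r,p_1,\dots,p_m\ge1$ the $m$-linear map $M_r(M_{p_1})\times\cdots\times M_r(M_{p_m})\to M_{\tau(r)}(M_{p_1\cdots p_m})$, $(\beta_1\otimes\alpha_1,\dots,\beta_m\otimes\alpha_m)\mapsto\lambda_r(\beta_1,\dots,\beta_m)\otimes\alpha_1\otimes\cdots\otimes\alpha_m$, is positive: it maps tuples of positive semidefinite matrices to positive semidefinite matrices. For complex vector spaces $V_1,\dots,V_m$ let $\otimes_{\lambda_j}:M_j(V_1)\times\cdots\times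 M_j(V_m)\to M_{\tau(j)}(V_1\otimes\cdots\otimes V_m)$ be the $m$-linear map with $(\alpha_1\otimes v_1,\dots,\alpha_m\otimes v_m)\mapsto\lambda_j(\alpha_1,\dots,\alpha_m)\otimes v_1\otimes\cdots\otimes v_m$. For operator spaces $V_t$ and $u\in M_n(\bigotimes_i V_i)$ put $$\|u\|_{\lambda,n}=\inf\{\|\alpha\|\,\|v_1\|\cdots\|v_m\|\,\|\beta\| : u=\alpha\otimes_{\lambda_j}(v_1,\dots,v_m)\beta\},$$ the infimum being over $j\in\mathbb N$, $\alpha\in M_{n,\tau(j)}$, $\beta\in M_{\tau(j),n}$, $v_t\in M_j(V_t)$. For matrix ordered operator spaces $V_t$ give $\bigotimes_iV_i$ the involution $(v_1\otimes\cdots\otimes v_m)^*=v_1^*\otimes\cdots\otimes v_m^*$ and put $$\mathcal C_n=\{\alpha\otimes_{\lambda_j}(v_1,\dots,v_m)\alpha^*: j\in\mathbb N,\ \alpha\in M_{n,\tau(j)},\ v_t\in M_j(V_t)^+\},$$ $$\|z\|_{\Lambda,n}=\inf\Big\{\max\{\|u\|_{\lambda,n},\|u'\|_{\lambda,n}\}:\begin{pmatrix}u&z\\z^*&u'\end{pmatrix}\in\mathcal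 C_{2n}\Big\}\qquad(z\in M_n(\textstyle\bigotimes_iV_i)).$$ **Proposition.** Let $V_1,\dots,V_m$ be matrix regular operator spaces and let $\lambda$ satisfy (E1)–(E3) and (O1)–(O3). Then for every $n\ge1$: 1. $\mathcal C_n$ is a proper cone in $M_n(\bigotimes_iV_i)$: it consists of self-adjoint elements, contains $0$, is closed under addition and under multiplication by non-negative reals, and $\mathcal C_n\cap-\mathcal C_n=\{0\}$. 2. For every $z\in M_n(\bigotimes_iV_i)$ there are $u_1,u_2\in\mathcal C_n$ with $\begin{pmatrix}u_1&z\\z^*&u_2\end{pmatrix}\in\mathcal C_{2n}$. 3. $\|\cdot\|_{\Lambda,n}$ is a norm on $M_n(\bigotimes_iV_i)$. -/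

import Mathlib

open scoped Matrix.Norms.L2Operator TensorProduct ComplexOrder

noncomputable section

namespace LambdaTensor

universe u

/-! ### Norms, cones and matrices over a vector space

A scalar matrix carries its operator norm (between Euclidean spaces). -/

/-- `p` is a norm on the complex vector space `E`. -/
structure IsNorm {E : Type*} [AddCommGroup E] [Module ℂ E] (p : E → ℝ) : Prop where
  nonneg : ∀ x, 0 ≤ p x
  eq_zero_iff : ∀ x, p x = 0 ↔ x = 0
  smul : ∀ (c : ℂ) x, p (c • x) = ‖c‖ * p x
  add_le : ∀ x y, p (x + y) ≤ p x + p y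

/-- `C` is a (convex, pointed) cone in the vector space `E`. -/
structure IsCone {E : Type*} [AddCommGroup E] [Module ℂ E] (C : Set E) : Prop where
  zero_mem : (0 : E) ∈ C
  add_mem : ∀ x ∈ C, ∀ y ∈ C, x + y ∈ C
  smul_mem : ∀ t : ℝ, 0 ≤ t → ∀ x ∈ C, (t : ℂ) • x ∈ C

/-- `C` is a proper cone: a cone with `C ∩ -C = {0}`. -/
structure IsProperCone {E : Type*} [AddCommGroup E] [Module ℂ E] (C : Set E) : Prop
    extends IsCone C where
  eq_zero_of_neg_mem : ∀ x ∈ C, -x ∈ C → x = 0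

/-- The product `α v β` of a matrix `v` over a vector space with scalar matrices. -/
def sandwich {E ι κ κ' ι' : Type*} [AddCommGroup E] [Module ℂ E] [Fintype κ] [Fintype κ']
    (α : Matrix ι κ ℂ) (v : Matrix κ κ' E) (β : Matrix κ' ι' ℂ) : Matrix ι ι' E :=
  Matrix.of fun i j => ∑ k, ∑ l, (α i k * β l j) • v k l

/-- The block matrix with rows `a, b` and `c, d`, as an element of `M_{n+k}(E)`. -/
def block {E : Type*} {n k : ℕ} (a : Matrix (Fin n) (Fin n) E) (b : Matrix (Fin n) (Fin k) E)
    (c : Matrix (Fin k) (Fin n) E) (d : Matrix (Fin k) (Fin k) E) :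
    Matrix (Fin (n + k)) (Fin (n + k)) E :=
  Matrix.reindex finSumFinEquiv finSumFinEquiv (Matrix.fromBlocks a b c d)

/-! ### Matrix ordered and matrix regular operator spaces -/

/-- An (abstract, not necessarily complete) operator space structure on `V`: a norm on each
`M_n(V)` subject to Ruan's axioms. (The space `M_0(V)` is zero, so that `n = 0` adds nothing.) -/
structure OperatorSpace (V : Type u) [AddCommGroup V] [Module ℂ V] where
  mnorm : ∀ {n : ℕ}, Matrix (Fin n) (Fin n) V → ℝ
  isNorm : ∀ n : ℕ, IsNorm (mnorm (n := n))
  mnorm_diag : ∀ {n k : ℕ} (v : Matrix (Fin n) (Fin n) V) (w : Matrix (Fin k) (Fin k) V),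
    mnorm (block v 0 0 w) = max (mnorm v) (mnorm w)
  mnorm_sandwich_le : ∀ {n k : ℕ} (α : Matrix (Fin k) (Fin n) ℂ) (v : Matrix (Fin n) (Fin n) V)
    (β : Matrix (Fin n) (Fin k) ℂ), mnorm (sandwich α v β) ≤ ‖α‖ * mnorm v * ‖β‖

/-- A matrix ordered operator space structure on a complex vector space `V` with a conjugate
linear involution: the cones `pos n = M_n(V)⁺` consist of self-adjoint elements, are compatible
with scalar matrices and norm closed, and the involution is isometric on each `M_n(V)`. -/
structure MatrixOrderedOperatorSpace (V : Type u) [AddCommGroup V] [Module ℂ V]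
    [StarAddMonoid V] [StarModule ℂ V] extends OperatorSpace V where
  pos : ∀ n : ℕ, Set (Matrix (Fin n) (Fin n) V)
  pos_isCone : ∀ n, IsCone (pos n)
  pos_selfAdjoint : ∀ n, ∀ v ∈ pos n, v.conjTranspose = v
  pos_sandwich : ∀ {n k : ℕ} (A : Matrix (Fin n) (Fin k) ℂ), ∀ v ∈ pos n,
    sandwich A.conjTranspose v A ∈ pos k
  mnorm_conjTranspose : ∀ {n : ℕ} (v : Matrix (Fin n) (Fin n) V),
    mnorm v.conjTranspose = mnorm v
  pos_closed : ∀ (n : ℕ) (v : Matrix (Fin n) (Fin n) V),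
    (∀ ε : ℝ, 0 < ε → ∃ w ∈ pos n, mnorm (v - w) < ε) → v ∈ pos n

/-- Matrix regularity; `-u ≤ v ≤ u` means `v + u ∈ M_n(V)⁺` and `u - v ∈ M_n(V)⁺`. -/
structure MatrixOrderedOperatorSpace.IsMatrixRegular {V : Type u} [AddCommGroup V] [Module ℂ V]
    [StarAddMonoid V] [StarModule ℂ V] (O : MatrixOrderedOperatorSpace V) : Prop where
  mnorm_le : ∀ n : ℕ, 0 < n → ∀ v u : Matrix (Fin n) (Fin n) V, v.conjTranspose = v →
    u ∈ O.pos n → v + u ∈ O.pos n → u - v ∈ O.pos n → O.mnorm v ≤ O.mnorm u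
  exists_bound : ∀ n : ℕ, 0 < n → ∀ v : Matrix (Fin n) (Fin n) V, v.conjTranspose = v →
    O.mnorm v ≤ 1 → ∃ u ∈ O.pos n, O.mnorm u ≤ 1 ∧ v + u ∈ O.pos n ∧ u - v ∈ O.pos n

/-! ### Sequences of matrix products -/

/-- A sequence `λ_k : M_k × ⋯ × M_k → M_{τ(k)}` of `m`-linear maps. Only `k ≥ 1` is used. -/
structure MatrixProducts (m : ℕ) where
  τ : ℕ → ℕ
  prod : ∀ k : ℕ, MultilinearMap ℂ (fun _ : Fin m => Matrix (Fin k) (Fin k) ℂ)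
    (Matrix (Fin (τ k)) (Fin (τ k)) ℂ)

namespace MatrixProducts

variable {m : ℕ} (L : MatrixProducts m)

/-- Condition (E1). -/
def E1 : Prop :=
  ∀ k : ℕ, 0 < k → ∃ p : ℕ, 0 < p ∧
    ∃ (S : Matrix (Fin k) (Fin (L.τ p)) ℂ) (T : Matrix (Fin (L.τ p)) (Fin k) ℂ)
      (a : Fin k → Matrix (Fin p) (Fin p) ℂ),
      (∀ j : Fin k, S * L.prod p (fun _ => a j) * T = Matrix.single j j 1) ∧
      ∀ j : Fin m → Fin k, (¬ ∃ i, ∀ t, j t = i) → S * L.prod p (fun t => a (j t)) * T = 0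

/-- The matrix unit `ε_{i,j}` of size `r + s`; rows and columns are split in a first part of
size `r` and a second part of size `s`. -/
def unit (r s : ℕ) (i j : Fin r ⊕ Fin s) : Matrix (Fin r ⊕ Fin s) (Fin r ⊕ Fin s) ℂ :=
  Matrix.single i j 1

/-- `λ_{r+s}` at matrix units of size `r + s`. -/
def prodUnits (r s : ℕ) (i j : Fin m → Fin r ⊕ Fin s) :
    Matrix (Fin (L.τ (r + s))) (Fin (L.τ (r + s))) ℂ :=
  L.prod (r + s) fun t => Matrix.reindex finSumFinEquiv finSumFinEquiv (unit r s (i t) (j t))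

/-- The identity in (E2) for a given matrix `P`: the index pairs `(i_t, j_t)` run over
`{1,…,r}² ∪ {r+1,…,r+s}²`. The upper left block of `ε_{i,j}` is the unit `ε_{i,j}` of size `r`,
the lower right block is the unit `ε_{i-r,j-r}` of size `s`, each zero if out of range. -/
def DiagIdentity (r s : ℕ)
    (P : Matrix (Fin (L.τ r) ⊕ Fin (L.τ s)) (Fin (L.τ (r + s))) ℂ) : Prop :=
  ∀ i j : Fin m → Fin r ⊕ Fin s, (∀ t, (i t).isLeft = (j t).isLeft) →
    P * L.prodUnits r s i j * P.conjTranspose =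
      Matrix.fromBlocks (L.prod r fun t => (unit r s (i t) (j t)).toBlocks₁₁) 0
        0 (L.prod s fun t => (unit r s (i t) (j t)).toBlocks₂₂)

/-- The identity in (O2) for a given matrix `P`: the index pairs `(i_t, j_t)` run over
`{1,…,r} × {r+1,…,2r} ∪ {r+1,…,2r} × {1,…,r}`. The upper right block of `ε_{i,j}` is the unit
`ε_{i,j-r}` of size `r`, the lower left block is the unit `ε_{i-r,j}`, each zero if out of
range. -/
def AntiDiagIdentity (r : ℕ)
    (P : Matrix (Fin (L.τ r) ⊕ Fin (L.τ r)) (Fin (L.τ (r + r))) ℂ) : Prop :=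
  ∀ i j : Fin m → Fin r ⊕ Fin r, (∀ t, (i t).isLeft ≠ (j t).isLeft) →
    P * L.prodUnits r r i j * P.conjTranspose =
      Matrix.fromBlocks 0 (L.prod r fun t => (unit r r (i t) (j t)).toBlocks₁₂)
        (L.prod r fun t => (unit r r (i t) (j t)).toBlocks₂₁) 0

/-- Condition (E2). -/
def E2 : Prop :=
  ∀ r s : ℕ, 0 < r → 0 < s →
    ∃ P : Matrix (Fin (L.τ r) ⊕ Fin (L.τ s)) (Fin (L.τ (r + s))) ℂ,
      ‖P‖ ≤ 1 ∧ L.DiagIdentity r s P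

/-- Condition (E3). -/
def E3 : Prop :=
  L.prod 1 (fun _ => 1) = 1 ∧
    ∃ K : ℝ, ∀ k : ℕ, 0 < k → ∀ a : Fin m → Matrix (Fin k) (Fin k) ℂ,
      ‖L.prod k a‖ ≤ K * ∏ t, ‖a t‖

/-- Condition (O1). -/
def O1 : Prop :=
  ∀ r : ℕ, 0 < r → ∀ i j : Fin m → Fin r,
    L.prod r (fun t => Matrix.single (i t) (j t) 1) =
      (L.prod r (fun t => Matrix.single (j t) (i t) 1)).conjTranspose

/-- Condition (O2): the matrix `P` of (E2) for `s = r` may be chosen such that it also satisfies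
the antidiagonal identity. -/
def O2 : Prop :=
  ∀ r : ℕ, 0 < r → ∃ P : Matrix (Fin (L.τ r) ⊕ Fin (L.τ r)) (Fin (L.τ (r + r))) ℂ,
    ‖P‖ ≤ 1 ∧ L.DiagIdentity r r P ∧ L.AntiDiagIdentity r P

/-- The map `M_r(M_{p_1}) × ⋯ × M_r(M_{p_m}) → M_{τ(r)}(M_{p_1 ⋯ p_m})` obtained by tensorizing
`λ_r` with the Kronecker product of matrices. The rows of `M_{p_1 ⋯ p_m}` are indexed by
`∏ t, Fin (p t)`. -/
def tensorKronecker (r : ℕ) (p : Fin m → ℕ)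
    (x : ∀ t, Matrix (Fin r × Fin (p t)) (Fin r × Fin (p t)) ℂ) :
    Matrix (Fin (L.τ r) × (∀ t, Fin (p t))) (Fin (L.τ r) × (∀ t, Fin (p t))) ℂ :=
  Matrix.of fun a b => ∑ i : Fin m → Fin r, ∑ j : Fin m → Fin r,
    L.prod r (fun t => Matrix.single (i t) (j t) 1) a.1 b.1 *
      ∏ t, x t (i t, a.2 t) (j t, b.2 t)

/-- Condition (O3). -/
def O3 : Prop :=
  ∀ r : ℕ, 0 < r → ∀ p : Fin m → ℕ, (∀ t, 0 < p t) →
    ∀ x : ∀ t, Matrix (Fin r × Fin (p t)) (Fin r × Fin (p t)) ℂ,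
      (∀ t, (x t).PosSemidef) → (L.tensorKronecker r p x).PosSemidef

end MatrixProducts

/-! ### The algebraic tensor product: involution, cones, norms -/

section Tensor

variable {m : ℕ} {V : Fin m → Type u} [∀ t, AddCommGroup (V t)] [∀ t, Module ℂ (V t)]

section Star

variable [∀ t, StarAddMonoid (V t)] [∀ t, StarModule ℂ (V t)]

/-- The conjugate linear involution of the algebraic tensor product determined by
`(v_1 ⊗ ⋯ ⊗ v_m)* = v_1* ⊗ ⋯ ⊗ v_m*`. -/
def tensorStar : (⨂[ℂ] t, V t) →+ (⨂[ℂ] t, V t) :=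
  PiTensorProduct.liftAddHom
    (fun x : ℂ × (∀ t, V t) => star x.1 • PiTensorProduct.tprod ℂ fun t => star (x.2 t))
    (by
      intro r f i hf
      have h : (PiTensorProduct.tprod ℂ fun t => star (f t)) = 0 :=
        (PiTensorProduct.tprod ℂ).map_coord_zero i (by simp [hf])
      simp [h])
    (by intro f; simp)
    (by
      intro _ r f i a b
      have h : ∀ c : V i, (fun t => star (Function.update f i c t)) =
          Function.update (fun t => star (f t)) i (star c) := by
        intro c; funext t
        by_cases ht : t = i
        · subst ht; simp
        · simp [ht]
      simp only [h, star_add, MultilinearMap.map_update_add, smul_add])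
    (by intro r r' f; simp [add_smul])
    (by
      intro _ r f i r'
      have h : (fun t => star (Function.update f i (r' • f i) t)) =
          Function.update (fun t => star (f t)) i (star r' • star (f i)) := by
        funext t
        by_cases ht : t = i
        · subst ht; simp
        · simp [ht]
      simp only [h, MultilinearMap.map_update_smul, Function.update_eq_self, star_mul, smul_smul])

theorem tensorStar_smul_tprod (c : ℂ) (v : ∀ t, V t) :
    tensorStar (c • PiTensorProduct.tprod ℂ v) =
      star c • PiTensorProduct.tprod ℂ fun t => star (v t) := by
  rw [← PiTensorProduct.tprodCoeff_eq_smul_tprod]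
  rfl

/-- The adjoint of a matrix over the tensor product. -/
def tensorAdjoint {n : ℕ} (z : Matrix (Fin n) (Fin n) (⨂[ℂ] t, V t)) :
    Matrix (Fin n) (Fin n) (⨂[ℂ] t, V t) :=
  Matrix.of fun i j => tensorStar (z j i)

end Star

/-- The `m`-linear map `⊗_{λ_j} : M_j(V_1) × ⋯ × M_j(V_m) → M_{τ(j)}(V_1 ⊗ ⋯ ⊗ V_m)`,
`(α_1 ⊗ v_1, …, α_m ⊗ v_m) ↦ λ_j(α_1, …, α_m) ⊗ v_1 ⊗ ⋯ ⊗ v_m`. -/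
def lambdaTensor (L : MatrixProducts m) (j : ℕ) (v : ∀ t, Matrix (Fin j) (Fin j) (V t)) :
    Matrix (Fin (L.τ j)) (Fin (L.τ j)) (⨂[ℂ] t, V t) :=
  Matrix.of fun a b => ∑ k : Fin m → Fin j, ∑ l : Fin m → Fin j,
    L.prod j (fun t => Matrix.single (k t) (l t) 1) a b •
      PiTensorProduct.tprod ℂ fun t => v t (k t) (l t)

/-- The norm `‖u‖_{λ,n} = inf ‖α‖ ‖v_1‖ ⋯ ‖v_m‖ ‖β‖`, the infimum being taken over all
decompositions `u = α ⊗_{λ_j}(v_1, …, v_m) β`. -/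
def lambdaNorm (L : MatrixProducts m) (O : ∀ t, OperatorSpace (V t)) {n : ℕ}
    (u : Matrix (Fin n) (Fin n) (⨂[ℂ] t, V t)) : ℝ :=
  sInf {c : ℝ | ∃ j : ℕ, 0 < j ∧ ∃ (α : Matrix (Fin n) (Fin (L.τ j)) ℂ)
    (v : ∀ t, Matrix (Fin j) (Fin j) (V t)) (β : Matrix (Fin (L.τ j)) (Fin n) ℂ),
    u = sandwich α (lambdaTensor L j v) β ∧
      c = ‖α‖ * (∏ t, (O t).mnorm (v t)) * ‖β‖}

variable [∀ t, StarAddMonoid (V t)] [∀ t, StarModule ℂ (V t)]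

/-- The set `𝒞_n` of all `α ⊗_{λ_j}(v_1, …, v_m) α*` with `v_t ∈ M_j(V_t)⁺`. -/
def lambdaCone (L : MatrixProducts m) (O : ∀ t, MatrixOrderedOperatorSpace (V t)) (n : ℕ) :
    Set (Matrix (Fin n) (Fin n) (⨂[ℂ] t, V t)) :=
  {u | ∃ j : ℕ, 0 < j ∧ ∃ (α : Matrix (Fin n) (Fin (L.τ j)) ℂ)
    (v : ∀ t, Matrix (Fin j) (Fin j) (V t)),
    (∀ t, v t ∈ (O t).pos j) ∧ u = sandwich α (lambdaTensor L j v) α.conjTranspose}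

/-- `‖z‖_{Λ,n}`: the infimum of `max ‖u‖_{λ,n} ‖u'‖_{λ,n}` over all `u, u'` such that the block
matrix with rows `u, z` and `z*, u'` lies in `𝒞_{2n}`. -/
def bigLambdaNorm (L : MatrixProducts m) (O : ∀ t, MatrixOrderedOperatorSpace (V t)) {n : ℕ}
    (z : Matrix (Fin n) (Fin n) (⨂[ℂ] t, V t)) : ℝ :=
  sInf {c : ℝ | ∃ w w' : Matrix (Fin n) (Fin n) (⨂[ℂ] t, V t),
    block w z (tensorAdjoint z) w' ∈ lambdaCone L O (n + n) ∧
      c = max (lambdaNorm L (fun t => (O t).toOperatorSpace) w)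
        (lambdaNorm L (fun t => (O t).toOperatorSpace) w')}

end Tensor

end LambdaTensor

end

/-! The proof rests on three mechanisms.

Decompositions. (E1) cuts sums of elementary tensors out of a single value of `⊗_{λ_p}`, so every
`z` has the form `α ⊗_{λ_j}(v_1, …, v_m) β`. By (E2) the direct sum of two decompositions is again a
decomposition, with `v_t ⊕ w_t` in place of `v_t` and `w_t`. This makes `𝒞_n` closed under addition
and, since `‖P‖ ≤ 1`, gives the triangle inequality for `‖·‖_λ`.

Corners. In a matrix regular space every `v` is the corner of a positive block matrix with rows `a,
v` and `v*, d`. Inserting such matrices into `⊗_{λ_{2r}}` and compressing by the `P` of (O2) would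
give the block matrix wanted over the tensor product, were it not for the mixed terms, with some
factors from diagonal and some from antidiagonal blocks, on which (O2) is silent. Replacing `v_t` by
`s_t v_t` with signs `s_t` preserves positivity, being conjugation by `diag(1, s_t)`, and averaging
with the non-negative weights `(1 + ∏ s_t) / 2^m` removes exactly the mixed terms
(`sum_boolSign_prod`, `sum_sandwich_lambdaTensor_sign`).

Separation. The cones of a matrix regular space are closed and proper, so by Hahn–Banach bounded
positive functionals separate points, and their products separate points of the algebraic tensor
product. Product functionals map `𝒞_n` to positive semidefinite matrices by (O3) and are bounded for
`‖·‖_λ` by (E3). Properness of `𝒞_n` is thus inherited from scalar matrices. Definiteness of `‖·‖_Λ`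
follows since entries of the off-diagonal block `b` of a positive semidefinite matrix satisfy
`|b_ij|² ≤ ‖a‖ ‖d‖`, with `a` and `d` the diagonal blocks. -/

namespace LambdaTensor

universe u

/-! ### Products of matrices over a vector space with scalar matrices -/

section Sandwich

variable {E : Type*} [AddCommGroup E] [Module ℂ E]
  {ι κ κ' ι' μ μ' : Type*} [Fintype κ] [Fintype κ']

theorem sandwich_apply (α : Matrix ι κ ℂ) (v : Matrix κ κ' E) (β : Matrix κ' ι' ℂ) (i : ι)
    (j : ι') : sandwich α v β i j = ∑ k, ∑ l, (α i k * β l j) • v k l := rfl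

theorem sandwich_add (α : Matrix ι κ ℂ) (v w : Matrix κ κ' E) (β : Matrix κ' ι' ℂ) :
    sandwich α (v + w) β = sandwich α v β + sandwich α w β := by
  ext i j
  simp [sandwich_apply, Finset.sum_add_distrib]

theorem sandwich_smul (c : ℂ) (α : Matrix ι κ ℂ) (v : Matrix κ κ' E) (β : Matrix κ' ι' ℂ) :
    sandwich α (c • v) β = c • sandwich α v β := by
  ext i j
  simp [sandwich_apply, Finset.smul_sum, smul_comm c]

theorem smul_sandwich (c : ℂ) (α : Matrix ι κ ℂ) (v : Matrix κ κ' E) (β : Matrix κ' ι' ℂ) :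
    sandwich (c • α) v β = c • sandwich α v β := by
  ext i j
  simp [sandwich_apply, Finset.smul_sum, mul_assoc, mul_smul]

theorem sandwich_smul_right (c : ℂ) (α : Matrix ι κ ℂ) (v : Matrix κ κ' E) (β : Matrix κ' ι' ℂ) :
    sandwich α v (c • β) = c • sandwich α v β := by
  ext i j
  simp [sandwich_apply, Finset.smul_sum, mul_smul, mul_left_comm _ c]

theorem sandwich_zero (α : Matrix ι κ ℂ) (β : Matrix κ' ι' ℂ) :
    sandwich α (0 : Matrix κ κ' E) β = 0 := by
  ext i j
  simp [sandwich_apply]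

theorem zero_sandwich (v : Matrix κ κ' E) (β : Matrix κ' ι' ℂ) :
    sandwich (0 : Matrix ι κ ℂ) v β = 0 := by
  ext i j
  simp [sandwich_apply]

theorem sandwich_zero_right (v : Matrix κ κ' E) (α : Matrix ι κ ℂ) :
    sandwich α v (0 : Matrix κ' ι' ℂ) = 0 := by
  ext i j
  simp [sandwich_apply]

theorem sandwich_sum {σ : Type*} (s : Finset σ) (α : Matrix ι κ ℂ) (v : σ → Matrix κ κ' E)
    (β : Matrix κ' ι' ℂ) : sandwich α (∑ x ∈ s, v x) β = ∑ x ∈ s, sandwich α (v x) β := by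
  classical
  induction s using Finset.induction_on with
  | empty => simp [sandwich_zero]
  | insert a s ha ih => rw [Finset.sum_insert ha, Finset.sum_insert ha, sandwich_add, ih]

theorem sandwich_sandwich [Fintype ι] [Fintype ι'] (α : Matrix μ ι ℂ) (α' : Matrix ι κ ℂ) (v : Matrix κ κ' E)
    (β' : Matrix κ' ι' ℂ) (β : Matrix ι' μ' ℂ) :
    sandwich α (sandwich α' v β') β = sandwich (α * α') v (β' * β) := by
  ext i j
  simp only [sandwich_apply, Matrix.mul_apply, Finset.smul_sum, smul_smul, Finset.sum_mul,
    Finset.mul_sum, Finset.sum_smul]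
  calc _ = ∑ x, ∑ k, ∑ x1, ∑ l, ((α i x * β x1 j) * (α' x k * β' l x1)) • v k l := by
        refine Finset.sum_congr rfl fun x _ => ?_
        rw [Finset.sum_comm]
    _ = ∑ k, ∑ x, ∑ l, ∑ x1, ((α i x * β x1 j) * (α' x k * β' l x1)) • v k l := by
        rw [Finset.sum_comm]
        refine Finset.sum_congr rfl fun x _ => Finset.sum_congr rfl fun y _ => ?_
        rw [Finset.sum_comm]
    _ = ∑ k, ∑ l, ∑ x, ∑ x1, ((α i x * β x1 j) * (α' x k * β' l x1)) • v k l := by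
        refine Finset.sum_congr rfl fun x _ => ?_
        rw [Finset.sum_comm]
    _ = _ := by
        refine Finset.sum_congr rfl fun k _ => Finset.sum_congr rfl fun l _ => ?_
        rw [Finset.sum_comm]
        refine Finset.sum_congr rfl fun _ _ => Finset.sum_congr rfl fun _ _ => ?_
        congr 1
        ring

theorem one_sandwich [DecidableEq κ] [DecidableEq κ'] (v : Matrix κ κ' E) :
    sandwich (1 : Matrix κ κ ℂ) v (1 : Matrix κ' κ' ℂ) = v := by
  ext i j
  simp [sandwich_apply, Matrix.one_apply]

theorem sandwich_map (f : E →ₗ[ℂ] ℂ) (α : Matrix ι κ ℂ) (v : Matrix κ κ' E)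
    (β : Matrix κ' ι' ℂ) : (sandwich α v β).map f = α * v.map f * β := by
  ext i j
  simp only [Matrix.map_apply, sandwich_apply, map_sum, map_smul, smul_eq_mul, Matrix.mul_apply,
    Finset.sum_mul]
  rw [Finset.sum_comm]
  refine Finset.sum_congr rfl fun _ _ => Finset.sum_congr rfl fun _ _ => ?_
  ring

theorem sandwich_smul_vec (α : Matrix ι κ ℂ) (A : Matrix κ κ' ℂ) (x : E) (β : Matrix κ' ι' ℂ) :
    sandwich α (A.map fun c => c • x) β = (α * A * β).map fun c => c • x := by
  ext i j
  simp only [Matrix.map_apply, sandwich_apply, smul_smul, Matrix.mul_apply, Finset.sum_mul,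
    Finset.sum_smul]
  rw [Finset.sum_comm]
  refine Finset.sum_congr rfl fun _ _ => Finset.sum_congr rfl fun _ _ => ?_
  congr 1
  ring

/-- A compression of a matrix to a submatrix is a product with scalar matrices. -/
theorem sandwich_submatrix_one [DecidableEq κ] [DecidableEq κ'] (v : Matrix κ κ' E) (e : ι → κ)
    (f : ι' → κ') :
    sandwich ((1 : Matrix κ κ ℂ).submatrix e id) v ((1 : Matrix κ' κ' ℂ).submatrix id f) =
      v.submatrix e f := by
  ext i j
  simp [sandwich_apply, Matrix.one_apply]

theorem sandwich_fromCols_fromRows_fromBlocks {κ₁ κ₂ κ₁' κ₂' : Type*} [Fintype κ₁] [Fintype κ₂]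
    [Fintype κ₁'] [Fintype κ₂'] (α₁ : Matrix ι κ₁ ℂ) (α₂ : Matrix ι κ₂ ℂ)
    (v₁₁ : Matrix κ₁ κ₁' E) (v₁₂ : Matrix κ₁ κ₂' E) (v₂₁ : Matrix κ₂ κ₁' E)
    (v₂₂ : Matrix κ₂ κ₂' E) (β₁ : Matrix κ₁' ι' ℂ) (β₂ : Matrix κ₂' ι' ℂ) :
    sandwich (Matrix.fromCols α₁ α₂) (Matrix.fromBlocks v₁₁ v₁₂ v₂₁ v₂₂)
        (Matrix.fromRows β₁ β₂) =
      sandwich α₁ v₁₁ β₁ + sandwich α₁ v₁₂ β₂ + (sandwich α₂ v₂₁ β₁ + sandwich α₂ v₂₂ β₂) := by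
  ext i j
  simp only [sandwich_apply, Matrix.add_apply, Fintype.sum_sum_type, Matrix.fromCols_apply_inl,
    Matrix.fromCols_apply_inr, Matrix.fromRows_apply_inl, Matrix.fromRows_apply_inr,
    Matrix.fromBlocks_apply₁₁, Matrix.fromBlocks_apply₁₂, Matrix.fromBlocks_apply₂₁,
    Matrix.fromBlocks_apply₂₂, Finset.sum_add_distrib]
  abel

theorem sandwich_fromBlocks_diag {κ₁ κ₂ ι₁ ι₂ κ₁' κ₂' ι₁' ι₂' : Type*} [Fintype κ₁] [Fintype κ₂]
    [Fintype κ₁'] [Fintype κ₂'] (α₁ : Matrix ι₁ κ₁ ℂ) (α₂ : Matrix ι₂ κ₂ ℂ)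
    (v₁₁ : Matrix κ₁ κ₁' E) (v₁₂ : Matrix κ₁ κ₂' E) (v₂₁ : Matrix κ₂ κ₁' E)
    (v₂₂ : Matrix κ₂ κ₂' E) (β₁ : Matrix κ₁' ι₁' ℂ) (β₂ : Matrix κ₂' ι₂' ℂ) :
    sandwich (Matrix.fromBlocks α₁ 0 0 α₂) (Matrix.fromBlocks v₁₁ v₁₂ v₂₁ v₂₂)
        (Matrix.fromBlocks β₁ 0 0 β₂) =
      Matrix.fromBlocks (sandwich α₁ v₁₁ β₁) (sandwich α₁ v₁₂ β₂) (sandwich α₂ v₂₁ β₁)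
        (sandwich α₂ v₂₂ β₂) := by
  ext (i | i) (j | j) <;> simp [sandwich_apply]

/-- Reindexing a matrix is a product with scalar matrices. -/
theorem reindex_sandwich (e : ι ≃ μ) (f : ι' ≃ μ') (α : Matrix ι κ ℂ) (v : Matrix κ κ' E)
    (β : Matrix κ' ι' ℂ) :
    Matrix.reindex e f (sandwich α v β) =
      sandwich (α.submatrix e.symm id) v (β.submatrix id f.symm) := rfl

end Sandwich

/-! ### The multilinear maps `⊗_{λ_j}` -/

section LambdaTensor

variable {m : ℕ} {V : Fin m → Type u} [∀ t, AddCommGroup (V t)] [∀ t, Module ℂ (V t)]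
  (L : MatrixProducts m)

theorem lambdaTensor_apply (j : ℕ) (v : ∀ t, Matrix (Fin j) (Fin j) (V t)) (a b : Fin (L.τ j)) :
    lambdaTensor L j v a b = ∑ k : Fin m → Fin j, ∑ l : Fin m → Fin j,
      L.prod j (fun t => Matrix.single (k t) (l t) 1) a b •
        PiTensorProduct.tprod ℂ fun t => v t (k t) (l t) := rfl

theorem lambdaTensor_eq_zero (j : ℕ) (v : ∀ t, Matrix (Fin j) (Fin j) (V t)) (t : Fin m)
    (ht : v t = 0) : lambdaTensor L j v = 0 := by
  ext a b
  rw [lambdaTensor_apply]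
  refine Finset.sum_eq_zero fun k _ => Finset.sum_eq_zero fun l _ => ?_
  rw [MultilinearMap.map_coord_zero (PiTensorProduct.tprod ℂ) t (by simp [ht]), smul_zero]

theorem lambdaTensor_smul (j : ℕ) (c : Fin m → ℂ) (v : ∀ t, Matrix (Fin j) (Fin j) (V t)) :
    lambdaTensor L j (fun t => c t • v t) = (∏ t, c t) • lambdaTensor L j v := by
  ext a b
  rw [Matrix.smul_apply, lambdaTensor_apply, lambdaTensor_apply]
  simp only [Finset.smul_sum, Matrix.smul_apply, MultilinearMap.map_smul_univ]
  refine Finset.sum_congr rfl fun k _ => Finset.sum_congr rfl fun l _ => ?_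
  rw [smul_comm]

/-- A multilinear map on matrices, expanded in matrix units. -/
theorem prod_eq_sum_single (j : ℕ) (x : Fin m → Matrix (Fin j) (Fin j) ℂ) :
    L.prod j x = ∑ k : Fin m → Fin j, ∑ l : Fin m → Fin j,
      (∏ t, x t (k t) (l t)) • L.prod j (fun t => Matrix.single (k t) (l t) 1) := by
  have h : x = fun t => ∑ p : Fin j × Fin j, x t p.1 p.2 • Matrix.single p.1 p.2 (1 : ℂ) := by
    funext t
    rw [Fintype.sum_prod_type]
    conv_lhs => rw [Matrix.matrix_eq_sum_single (x t)]
    simp [Matrix.smul_single]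
  conv_lhs => rw [h, MultilinearMap.map_sum]
  rw [← (Equiv.arrowProdEquivProdArrow (Fin m) (fun _ => Fin j) (fun _ => Fin j)).symm.sum_comp,
    Fintype.sum_prod_type]
  refine Finset.sum_congr rfl fun k _ => Finset.sum_congr rfl fun l _ => ?_
  rw [MultilinearMap.map_smul_univ]
  rfl

/-- The value of `⊗_{λ_j}` at elementary tensors. -/
theorem lambdaTensor_smul_vec (j : ℕ) {σ : Type*} [Fintype σ]
    (a : σ → Matrix (Fin j) (Fin j) ℂ) (x : ∀ t, σ → V t) :
    lambdaTensor L j (fun t => ∑ s, (a s).map fun c => c • x t s) =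
      ∑ s : Fin m → σ, (L.prod j fun t => a (s t)).map
        fun c => c • PiTensorProduct.tprod ℂ fun t => x t (s t) := by
  classical
  ext p q
  simp only [Matrix.sum_apply, Matrix.map_apply, lambdaTensor_apply, MultilinearMap.map_sum,
    MultilinearMap.map_smul_univ, Finset.smul_sum]
  have h : ∀ s : Fin m → σ, (L.prod j fun t => a (s t)) p q =
      ∑ k : Fin m → Fin j, ∑ l : Fin m → Fin j, (∏ t, a (s t) (k t) (l t)) *
        L.prod j (fun t => Matrix.single (k t) (l t) 1) p q := by
    intro s
    rw [prod_eq_sum_single L]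
    simp [Matrix.sum_apply]
  simp only [h, Finset.sum_smul, smul_smul]
  simp_rw [mul_comm]
  symm
  rw [Finset.sum_comm]
  refine Finset.sum_congr rfl fun k _ => ?_
  rw [Finset.sum_comm]

/-- Blocks of `⊗_λ` for matrices indexed by a larger set. -/
theorem sum_prod_submatrix_single {ι : Type*} [Fintype ι] [DecidableEq ι] (r : ℕ)
    (e f : Fin r → ι) (he : e.Injective) (hf : f.Injective) (W : ∀ t, Matrix ι ι (V t))
    (a b : Fin (L.τ r)) :
    ∑ k : Fin m → ι, ∑ l : Fin m → ι,
        L.prod r (fun t => (Matrix.single (k t) (l t) 1).submatrix e f) a b •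
          PiTensorProduct.tprod ℂ (fun t => W t (k t) (l t)) =
      lambdaTensor L r (fun t => (W t).submatrix e f) a b := by
  rw [lambdaTensor_apply]
  symm
  have hz : ∀ k l : Fin m → ι, (∃ t, (Matrix.single (k t) (l t) (1 : ℂ)).submatrix e f = 0) →
      L.prod r (fun t => (Matrix.single (k t) (l t) 1).submatrix e f) = 0 := by
    rintro k l ⟨t, ht⟩
    exact MultilinearMap.map_coord_zero _ t ht
  -- Only multi-indices all of whose entries lie in the range of `e` (and, below, of `f`)
  -- contribute: otherwise one compressed matrix unit vanishes, and with it the multilinear value.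
  refine Fintype.sum_of_injective (fun k t => e (k t)) (fun k k' h => funext fun t =>
    he (congrFun h t)) _ _ (fun k hk => Finset.sum_eq_zero fun l _ => ?_) (fun k => ?_)
  · have : ∃ t, ∀ i, e i ≠ k t := by
      by_contra! H
      choose g hg using H
      exact hk ⟨g, funext hg⟩
    obtain ⟨t, ht⟩ := this
    rw [hz k l ⟨t, by ext i j; simp [(ht i).symm]⟩]
    simp
  refine Fintype.sum_of_injective (fun k t => f (k t)) (fun k k' h => funext fun t =>
    hf (congrFun h t)) _ _ (fun l hl => ?_) (fun l => ?_)
  · have : ∃ t, ∀ i, f i ≠ l t := by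
      by_contra! H
      choose g hg using H
      exact hl ⟨g, funext hg⟩
    obtain ⟨t, ht⟩ := this
    rw [hz _ l ⟨t, by ext i j; simp [(ht j).symm]⟩]
    simp
  · have : ∀ t, (Matrix.single (e (k t)) (f (l t)) (1 : ℂ)).submatrix e f =
        Matrix.single (k t) (l t) 1 := by
      intro t
      ext i j
      simp [Matrix.single_apply, he.eq_iff, hf.eq_iff]
    simp [this]

theorem lambdaTensor_reindex (r s : ℕ) (W : ∀ t, Matrix (Fin r ⊕ Fin s) (Fin r ⊕ Fin s) (V t))
    (a b : Fin (L.τ (r + s))) :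
    lambdaTensor L (r + s) (fun t => Matrix.reindex finSumFinEquiv finSumFinEquiv (W t)) a b =
      ∑ k : Fin m → Fin r ⊕ Fin s, ∑ l : Fin m → Fin r ⊕ Fin s,
        L.prodUnits r s k l a b • PiTensorProduct.tprod ℂ (fun t => W t (k t) (l t)) := by
  rw [lambdaTensor_apply]
  let e : (Fin m → Fin r ⊕ Fin s) ≃ (Fin m → Fin (r + s)) :=
    Equiv.arrowCongr (Equiv.refl _) finSumFinEquiv
  rw [← e.sum_comp]
  refine Finset.sum_congr rfl fun k _ => ?_
  rw [← e.sum_comp]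
  refine Finset.sum_congr rfl fun l _ => ?_
  have h : ∀ t, Matrix.single (e k t) (e l t) (1 : ℂ) =
      Matrix.reindex finSumFinEquiv finSumFinEquiv (MatrixProducts.unit r s (k t) (l t)) := by
    intro t
    simp [MatrixProducts.unit, e]
  simp only [h, MatrixProducts.prodUnits]
  congr 2
  simp [e]

/-- (E2) and (O2) speak only of matrix units. This expansion moves the compression onto the units
and leaves the entries of `W` in the tensors. -/
theorem sandwich_lambdaTensor_reindex {ι κ : Type*} (r s : ℕ)
    (W : ∀ t, Matrix (Fin r ⊕ Fin s) (Fin r ⊕ Fin s) (V t))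
    (P : Matrix ι (Fin (L.τ (r + s))) ℂ) (Q : Matrix (Fin (L.τ (r + s))) κ ℂ) (a : ι) (b : κ) :
    sandwich P (lambdaTensor L (r + s)
        (fun t => Matrix.reindex finSumFinEquiv finSumFinEquiv (W t))) Q a b =
      ∑ k : Fin m → Fin r ⊕ Fin s, ∑ l : Fin m → Fin r ⊕ Fin s,
        (P * L.prodUnits r s k l * Q) a b • PiTensorProduct.tprod ℂ (fun t => W t (k t) (l t)) := by
  have h : lambdaTensor L (r + s)
      (fun t => Matrix.reindex finSumFinEquiv finSumFinEquiv (W t)) =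
      ∑ k : Fin m → Fin r ⊕ Fin s, ∑ l : Fin m → Fin r ⊕ Fin s, (L.prodUnits r s k l).map
        fun c => c • PiTensorProduct.tprod ℂ fun t => W t (k t) (l t) := by
    ext p q
    rw [lambdaTensor_reindex]
    simp [Matrix.sum_apply]
  rw [h, sandwich_sum]
  simp only [sandwich_sum, sandwich_smul_vec, Matrix.sum_apply, Matrix.map_apply]

/-- The identity of (E2) for arbitrary block diagonal matrices. -/
theorem sandwich_lambdaTensor_diag (r s : ℕ)
    (P : Matrix (Fin (L.τ r) ⊕ Fin (L.τ s)) (Fin (L.τ (r + s))) ℂ) (hP : L.DiagIdentity r s P)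
    (v : ∀ t, Matrix (Fin r) (Fin r) (V t)) (w : ∀ t, Matrix (Fin s) (Fin s) (V t)) :
    sandwich P (lambdaTensor L (r + s) fun t => block (v t) 0 0 (w t)) P.conjTranspose =
      Matrix.fromBlocks (lambdaTensor L r v) 0 0 (lambdaTensor L s w) := by
  let W : ∀ t, Matrix (Fin r ⊕ Fin s) (Fin r ⊕ Fin s) (V t) :=
    fun t => Matrix.fromBlocks (v t) 0 0 (w t)
  have key : ∀ (a b : Fin (L.τ r) ⊕ Fin (L.τ s)) (k l : Fin m → Fin r ⊕ Fin s),
      (P * L.prodUnits r s k l * P.conjTranspose) a b •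
        PiTensorProduct.tprod ℂ (fun t => W t (k t) (l t)) =
      Matrix.fromBlocks
        (L.prod r fun t => (Matrix.single (k t) (l t) (1 : ℂ)).submatrix Sum.inl Sum.inl) 0
        0 (L.prod s fun t => (Matrix.single (k t) (l t) (1 : ℂ)).submatrix Sum.inr Sum.inr) a b •
        PiTensorProduct.tprod ℂ (fun t => W t (k t) (l t)) := by
    intro a b k l
    by_cases h : ∀ t, (k t).isLeft = (l t).isLeft
    · rw [hP k l h]
      rfl
    · push Not at h
      obtain ⟨t, ht⟩ := h
      -- For index pairs not covered by (E2), some factor is an entry of a zero block, so the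
      -- unknown coefficient is irrelevant.
      have hW : W t (k t) (l t) = 0 := by
        rcases hk : k t with i | i <;> rcases hl : l t with j | j <;> simp_all [W]
      rw [MultilinearMap.map_coord_zero (PiTensorProduct.tprod ℂ) t hW, smul_zero, smul_zero]
  ext a b
  change sandwich P (lambdaTensor L (r + s) fun t =>
    Matrix.reindex finSumFinEquiv finSumFinEquiv (W t)) P.conjTranspose a b = _
  rw [sandwich_lambdaTensor_reindex]
  simp only [key]
  rcases a with a | a <;> rcases b with b | b
  · simp only [Matrix.fromBlocks_apply₁₁]
    exact sum_prod_submatrix_single L r _ _ Sum.inl_injective Sum.inl_injective W a b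
  · simp
  · simp
  · simp only [Matrix.fromBlocks_apply₂₂]
    exact sum_prod_submatrix_single L s _ _ Sum.inr_injective Sum.inr_injective W a b

open Classical in
/-- The identities of (O2) for arbitrary matrices: the terms of `⊗_{λ_{2r}}` in which all factors
are taken from the diagonal blocks, or all from the antidiagonal blocks. -/
theorem sum_prodUnits_eq_fromBlocks (hm : 0 < m) (r : ℕ)
    (P : Matrix (Fin (L.τ r) ⊕ Fin (L.τ r)) (Fin (L.τ (r + r))) ℂ) (hP : L.DiagIdentity r r P)
    (hP' : L.AntiDiagIdentity r P) (W : ∀ t, Matrix (Fin r ⊕ Fin r) (Fin r ⊕ Fin r) (V t))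
    (a b : Fin (L.τ r) ⊕ Fin (L.τ r)) :
    ∑ k : Fin m → Fin r ⊕ Fin r, ∑ l : Fin m → Fin r ⊕ Fin r,
      (((if ∀ t, (k t).isLeft = (l t).isLeft then 1 else 0) +
        (if ∀ t, (k t).isLeft ≠ (l t).isLeft then 1 else 0) : ℂ) *
        (P * L.prodUnits r r k l * P.conjTranspose) a b) •
          PiTensorProduct.tprod ℂ (fun t => W t (k t) (l t)) =
      Matrix.fromBlocks (lambdaTensor L r fun t => (W t).toBlocks₁₁)
        (lambdaTensor L r fun t => (W t).toBlocks₁₂) (lambdaTensor L r fun t => (W t).toBlocks₂₁)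
        (lambdaTensor L r fun t => (W t).toBlocks₂₂) a b := by
  have hz : ∀ (k l : Fin m → Fin r ⊕ Fin r) (e f : Fin r → Fin r ⊕ Fin r) (t : Fin m),
      (Matrix.single (k t) (l t) (1 : ℂ)).submatrix e f = 0 →
      L.prod r (fun t => (Matrix.single (k t) (l t) (1 : ℂ)).submatrix e f) = 0 :=
    fun k l e f t ht => MultilinearMap.map_coord_zero _ t ht
  have key : ∀ (k l : Fin m → Fin r ⊕ Fin r),
      (((if ∀ t, (k t).isLeft = (l t).isLeft then 1 else 0) +
        (if ∀ t, (k t).isLeft ≠ (l t).isLeft then 1 else 0) : ℂ) *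
        (P * L.prodUnits r r k l * P.conjTranspose) a b) =
      Matrix.fromBlocks
        (L.prod r fun t => (Matrix.single (k t) (l t) (1 : ℂ)).submatrix Sum.inl Sum.inl)
        (L.prod r fun t => (Matrix.single (k t) (l t) (1 : ℂ)).submatrix Sum.inl Sum.inr)
        (L.prod r fun t => (Matrix.single (k t) (l t) (1 : ℂ)).submatrix Sum.inr Sum.inl)
        (L.prod r fun t => (Matrix.single (k t) (l t) (1 : ℂ)).submatrix Sum.inr Sum.inr) a b := by
    intro k l
    have hd : ∀ t, (k t).isLeft ≠ (l t).isLeft →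
        (Matrix.single (k t) (l t) (1 : ℂ)).submatrix
          (Sum.inl : Fin r → Fin r ⊕ Fin r) (Sum.inl : Fin r → Fin r ⊕ Fin r) = 0 ∧
        (Matrix.single (k t) (l t) (1 : ℂ)).submatrix
          (Sum.inr : Fin r → Fin r ⊕ Fin r) (Sum.inr : Fin r → Fin r ⊕ Fin r) = 0 := by
      intro t ht
      constructor <;> ext i j <;> rcases hk : k t with i' | i' <;>
        rcases hl : l t with j' | j' <;> simp_all
    have hs : ∀ t, (k t).isLeft = (l t).isLeft →
        (Matrix.single (k t) (l t) (1 : ℂ)).submatrix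
          (Sum.inl : Fin r → Fin r ⊕ Fin r) (Sum.inr : Fin r → Fin r ⊕ Fin r) = 0 ∧
        (Matrix.single (k t) (l t) (1 : ℂ)).submatrix
          (Sum.inr : Fin r → Fin r ⊕ Fin r) (Sum.inl : Fin r → Fin r ⊕ Fin r) = 0 := by
      intro t ht
      constructor <;> ext i j <;> rcases hk : k t with i' | i' <;>
        rcases hl : l t with j' | j' <;> simp_all
    by_cases h : ∀ t, (k t).isLeft = (l t).isLeft
    -- As `m ≥ 1`, the all-diagonal and all-antidiagonal cases exclude each other, so the two
    -- indicators never add up to `2`.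
    · rw [if_pos h, if_neg fun H => H ⟨0, hm⟩ (h _), hP k l h,
        hz k l _ _ _ (hs ⟨0, hm⟩ (h _)).1, hz k l _ _ _ (hs ⟨0, hm⟩ (h _)).2, add_zero, one_mul]
      rfl
    · rw [if_neg h, zero_add]
      push Not at h
      obtain ⟨t, ht⟩ := h
      rw [hz k l _ _ _ (hd t ht).1, hz k l _ _ _ (hd t ht).2]
      by_cases h' : ∀ t, (k t).isLeft ≠ (l t).isLeft
      · rw [if_pos h', hP' k l h', one_mul]
        rfl
      · rw [if_neg h', zero_mul]
        push Not at h'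
        obtain ⟨t, ht⟩ := h'
        rw [hz k l _ _ _ (hs t ht).1, hz k l _ _ _ (hs t ht).2]
        simp
  simp only [key]
  rcases a with a | a <;> rcases b with b | b
  · exact sum_prod_submatrix_single L r _ _ Sum.inl_injective Sum.inl_injective W a b
  · exact sum_prod_submatrix_single L r _ _ Sum.inl_injective Sum.inr_injective W a b
  · exact sum_prod_submatrix_single L r _ _ Sum.inr_injective Sum.inl_injective W a b
  · exact sum_prod_submatrix_single L r _ _ Sum.inr_injective Sum.inr_injective W a b

end LambdaTensor

/-! ### Averages over signs -/

/-- The sign attached to a truth value. -/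
def boolSign (b : Bool) : ℂ := if b then 1 else -1

/-- Read `q t` as "the factor `t` comes from a diagonal block". The average of a product of
independent signs vanishes unless every sign occurs to an even power. The summand `1` of the weight
therefore detects that all `q t` hold, and the summand `∏ s_t` that none does. -/
theorem sum_boolSign_prod {m : ℕ} (q : Fin m → Prop) [DecidablePred q] :
    ∑ s : Fin m → Bool, (1 + ∏ t, boolSign (s t)) / 2 ^ m *
        ∏ t, (if q t then 1 else boolSign (s t)) =
      (if ∀ t, q t then 1 else 0) + if ∀ t, ¬ q t then 1 else 0 := by
  have h : ∀ f : Fin m → Bool → ℂ, ∑ s : Fin m → Bool, ∏ t, f t (s t) = ∏ t, ∑ b, f t b := by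
    intro f
    rw [Finset.prod_univ_sum, Fintype.piFinset_univ]
  -- With the weight distributed over the factors, each of the two summands is a product over `t`,
  -- and the sum over signs factorizes.
  have h1 : ∀ s : Fin m → Bool, (1 + ∏ t, boolSign (s t)) / 2 ^ m *
      ∏ t, (if q t then 1 else boolSign (s t)) =
      ∏ t, ((if q t then 1 else boolSign (s t)) / 2) +
      ∏ t, (boolSign (s t) * (if q t then 1 else boolSign (s t)) / 2) := by
    intro s
    rw [Finset.prod_div_distrib, Finset.prod_div_distrib, Finset.prod_mul_distrib]
    simp only [Finset.prod_const, Finset.card_univ, Fintype.card_fin]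
    ring
  simp only [h1, Finset.sum_add_distrib]
  rw [h fun t b => (if q t then 1 else boolSign b) / 2,
    h fun t b => boolSign b * (if q t then 1 else boolSign b) / 2]
  congr 1
  · rw [Finset.prod_congr rfl fun t _ => show ∑ b, (if q t then 1 else boolSign b) / 2 =
      if q t then 1 else 0 by by_cases hq : q t <;> (simp [hq, boolSign]; try norm_num)]
    simp [Finset.prod_ite_zero]
  · rw [Finset.prod_congr rfl fun t _ => show
      ∑ b, boolSign b * (if q t then 1 else boolSign b) / 2 =
      if ¬ q t then 1 else 0 by by_cases hq : q t <;> (simp [hq, boolSign]; try norm_num)]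
    rw [Finset.prod_ite_zero]
    simp

/-! ### Sign averaging for (O2) and decompositions from (E1) -/

section

variable {m : ℕ} {V : Fin m → Type u} [∀ t, AddCommGroup (V t)] [∀ t, Module ℂ (V t)]
  (L : MatrixProducts m)

/-- (O2) for arbitrary matrices, after averaging over the signs of the antidiagonal blocks. -/
theorem sum_sandwich_lambdaTensor_sign (hm : 0 < m) (r : ℕ)
    (P : Matrix (Fin (L.τ r) ⊕ Fin (L.τ r)) (Fin (L.τ (r + r))) ℂ) (hP : L.DiagIdentity r r P)
    (hP' : L.AntiDiagIdentity r P) (a b c d : ∀ t, Matrix (Fin r) (Fin r) (V t)) :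
    ∑ s : Fin m → Bool, ((1 + ∏ t, boolSign (s t)) / 2 ^ m) •
      sandwich P (lambdaTensor L (r + r) fun t =>
        block (a t) (boolSign (s t) • b t) (boolSign (s t) • c t) (d t)) P.conjTranspose =
      Matrix.fromBlocks (lambdaTensor L r a) (lambdaTensor L r b) (lambdaTensor L r c)
        (lambdaTensor L r d) := by
  classical
  let W : ∀ t, Matrix (Fin r ⊕ Fin r) (Fin r ⊕ Fin r) (V t) :=
    fun t => Matrix.fromBlocks (a t) (b t) (c t) (d t)
  ext p q
  have key := sum_prodUnits_eq_fromBlocks L hm r P hP hP' W p q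
  simp only [W, Matrix.toBlocks_fromBlocks₁₁, Matrix.toBlocks_fromBlocks₁₂,
    Matrix.toBlocks_fromBlocks₂₁, Matrix.toBlocks_fromBlocks₂₂] at key
  rw [← key, Matrix.sum_apply]
  have h : ∀ s : Fin m → Bool, sandwich P (lambdaTensor L (r + r) fun t =>
      block (a t) (boolSign (s t) • b t) (boolSign (s t) • c t) (d t)) P.conjTranspose p q =
      ∑ k : Fin m → Fin r ⊕ Fin r, ∑ l : Fin m → Fin r ⊕ Fin r,
        (∏ t, (if (k t).isLeft = (l t).isLeft then 1 else boolSign (s t))) •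
        (P * L.prodUnits r r k l * P.conjTranspose) p q •
          PiTensorProduct.tprod ℂ (fun t => W t (k t) (l t)) := by
    intro s
    refine (sandwich_lambdaTensor_reindex L r r (fun t => Matrix.fromBlocks (a t)
      (boolSign (s t) • b t) (boolSign (s t) • c t) (d t)) P P.conjTranspose p q).trans ?_
    refine Finset.sum_congr rfl fun k _ => Finset.sum_congr rfl fun l _ => ?_
    rw [smul_comm, ← MultilinearMap.map_smul_univ]
    congr 2
    funext t
    rcases k t with i | i <;> rcases l t with j | j <;> simp [W]
  simp only [Matrix.smul_apply, h, Finset.smul_sum, smul_smul]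
  rw [Finset.sum_comm]
  refine Finset.sum_congr rfl fun k _ => ?_
  rw [Finset.sum_comm]
  refine Finset.sum_congr rfl fun l _ => ?_
  rw [← Finset.sum_smul]
  congr 1
  rw [← sum_boolSign_prod, Finset.sum_mul]
  refine Finset.sum_congr rfl fun s _ => ?_
  ring

/-- By (E1), every matrix over the tensor product is of the form `α ⊗_{λ_j}(v_1, …, v_m) β`. -/
theorem exists_eq_sandwich_lambdaTensor (hm : 0 < m) (hE1 : L.E1) {n : ℕ}
    (z : Matrix (Fin n) (Fin n) (⨂[ℂ] t, V t)) :
    ∃ j : ℕ, 0 < j ∧ ∃ (α : Matrix (Fin n) (Fin (L.τ j)) ℂ)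
      (v : ∀ t, Matrix (Fin j) (Fin j) (V t)) (β : Matrix (Fin (L.τ j)) (Fin n) ℂ),
      z = sandwich α (lambdaTensor L j v) β := by
  classical
  -- `z` as a product `A diag(x_1, …, x_k) B` with elementary tensors `x_i`
  have h1 : ∃ (k : ℕ) (A : Matrix (Fin n) (Fin k) ℂ) (x : Fin k → ∀ t, V t)
      (B : Matrix (Fin k) (Fin n) ℂ),
      z = sandwich A (Matrix.diagonal fun i => PiTensorProduct.tprod ℂ (x i)) B := by
    have hs : ∀ w w' : Matrix (Fin n) (Fin n) (⨂[ℂ] t, V t),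
        (∃ (k : ℕ) (A : Matrix (Fin n) (Fin k) ℂ) (x : Fin k → ∀ t, V t)
          (B : Matrix (Fin k) (Fin n) ℂ),
          w = sandwich A (Matrix.diagonal fun i => PiTensorProduct.tprod ℂ (x i)) B) →
        (∃ (k : ℕ) (A : Matrix (Fin n) (Fin k) ℂ) (x : Fin k → ∀ t, V t)
          (B : Matrix (Fin k) (Fin n) ℂ),
          w' = sandwich A (Matrix.diagonal fun i => PiTensorProduct.tprod ℂ (x i)) B) →
        (∃ (k : ℕ) (A : Matrix (Fin n) (Fin k) ℂ) (x : Fin k → ∀ t, V t)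
          (B : Matrix (Fin k) (Fin n) ℂ),
          w + w' = sandwich A (Matrix.diagonal fun i => PiTensorProduct.tprod ℂ (x i)) B) := by
      rintro _ _ ⟨k, A, x, B, rfl⟩ ⟨k', A', x', B', rfl⟩
      -- A sum of two such products is one product with the concatenated diagonal.
      refine ⟨k + k', (Matrix.fromCols A A').submatrix id finSumFinEquiv.symm,
        Fin.append x x', (Matrix.fromRows B B').submatrix finSumFinEquiv.symm id, ?_⟩
      ext i j
      simp [sandwich_apply, Matrix.diagonal_apply, Fin.sum_univ_add]
    have h0 : ∃ (k : ℕ) (A : Matrix (Fin n) (Fin k) ℂ) (x : Fin k → ∀ t, V t)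
          (B : Matrix (Fin k) (Fin n) ℂ), (0 : Matrix (Fin n) (Fin n) (⨂[ℂ] t, V t)) =
            sandwich A (Matrix.diagonal fun i => PiTensorProduct.tprod ℂ (x i)) B :=
      ⟨0, 0, fun _ _ => 0, 0, (zero_sandwich _ _).symm⟩
    rw [Matrix.matrix_eq_sum_single z]
    refine Finset.sum_induction _ _ hs h0 fun i _ => Finset.sum_induction _ _ hs h0 fun j _ => ?_
    induction z i j using PiTensorProduct.induction_on with
    | smul_tprod c f =>
      refine ⟨1, Matrix.of fun i' _ => if i' = i then c else 0, fun _ => f,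
        Matrix.of fun _ j' => if j' = j then 1 else 0, ?_⟩
      ext i' j'
      by_cases hi : i = i' <;> by_cases hj : j = j' <;>
        simp [sandwich_apply, hi, hj, eq_comm]
    | add x y hx hy =>
      rw [Matrix.single_add]
      exact hs _ _ hx hy
  obtain ⟨k, A, x, B, rfl⟩ := h1
  -- (E1) concerns `k ≥ 1` only; for `k = 0` the matrix is zero.
  rcases Nat.eq_zero_or_pos k with rfl | hk
  · refine ⟨1, one_pos, 0, 0, 0, ?_⟩
    rw [zero_sandwich]
    ext i j
    simp [sandwich_apply]
  obtain ⟨p, hp, S, T, a, h2, h3⟩ := hE1 k hk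
  -- With `v_t = ∑ a_s ⊗ x_{s,t}`, multilinearity produces all `x_{s_1,1} ⊗ ⋯ ⊗ x_{s_m,m}`.
  -- Compression by `S` and `T` keeps the constant multi-indices and puts them on the diagonal.
  refine ⟨p, hp, A * S, fun t => ∑ s, (a s).map fun c => c • x s t, T * B, ?_⟩
  rw [← sandwich_sandwich]
  congr 1
  rw [lambdaTensor_smul_vec L p a (fun t s => x s t), sandwich_sum]
  simp only [sandwich_smul_vec]
  symm
  rw [← Fintype.sum_of_injective (fun (i : Fin k) (_ : Fin m) => i)
    (fun i j h => congrFun h ⟨0, hm⟩)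
    (fun i => (Matrix.single i i (1 : ℂ)).map fun c => c • PiTensorProduct.tprod ℂ (x i))]
  · ext i j
    by_cases hij : i = j
    · subst hij
      simp [Matrix.sum_apply, Matrix.single_apply]
    · simp only [Matrix.sum_apply, Matrix.map_apply, Matrix.single_apply, Matrix.diagonal_apply,
        if_neg hij]
      refine Finset.sum_eq_zero fun y _ => ?_
      rw [if_neg fun h => hij (h.1.symm.trans h.2), zero_smul]
  · intro s hs
    rw [h3 s fun ⟨i, hi⟩ => hs ⟨i, funext fun t => (hi t).symm⟩]
    ext i j
    simp
  · intro i
    rw [h2 i]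

/-! ### The involution on matrices over the tensor product -/

variable [∀ t, StarAddMonoid (V t)] [∀ t, StarModule ℂ (V t)]

theorem tensorStar_smul (c : ℂ) (x : ⨂[ℂ] t, V t) :
    tensorStar (c • x) = star c • tensorStar x := by
  induction x using PiTensorProduct.induction_on with
  | smul_tprod d f => rw [smul_smul, tensorStar_smul_tprod, tensorStar_smul_tprod, smul_smul,
      star_mul, mul_comm]
  | add x y hx hy => rw [smul_add, map_add, hx, hy, map_add, smul_add]

theorem tensorStar_tprod (v : ∀ t, V t) :
    tensorStar (PiTensorProduct.tprod ℂ v) = PiTensorProduct.tprod ℂ fun t => star (v t) := by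
  simpa using tensorStar_smul_tprod 1 v

theorem tensorAdjoint_add {n : ℕ} (z w : Matrix (Fin n) (Fin n) (⨂[ℂ] t, V t)) :
    tensorAdjoint (z + w) = tensorAdjoint z + tensorAdjoint w := by
  ext i j
  simp [tensorAdjoint]

theorem tensorAdjoint_zero {n : ℕ} :
    tensorAdjoint (0 : Matrix (Fin n) (Fin n) (⨂[ℂ] t, V t)) = 0 := by
  ext i j
  simp [tensorAdjoint]

theorem tensorAdjoint_smul {n : ℕ} (c : ℂ) (z : Matrix (Fin n) (Fin n) (⨂[ℂ] t, V t)) :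
    tensorAdjoint (c • z) = star c • tensorAdjoint z := by
  ext i j
  simp [tensorAdjoint, tensorStar_smul]

theorem tensorAdjoint_sandwich {n k : ℕ} (α : Matrix (Fin n) (Fin k) ℂ)
    (z : Matrix (Fin k) (Fin k) (⨂[ℂ] t, V t)) (β : Matrix (Fin k) (Fin n) ℂ) :
    tensorAdjoint (sandwich α z β) =
      sandwich β.conjTranspose (tensorAdjoint z) α.conjTranspose := by
  ext i j
  simp only [tensorAdjoint, Matrix.of_apply, sandwich_apply, map_sum, tensorStar_smul, star_mul,
    Matrix.conjTranspose_apply]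
  exact Finset.sum_comm

theorem tensorAdjoint_lambdaTensor (hO1 : L.O1) (j : ℕ) (hj : 0 < j)
    (v : ∀ t, Matrix (Fin j) (Fin j) (V t)) :
    tensorAdjoint (lambdaTensor L j v) = lambdaTensor L j fun t => (v t).conjTranspose := by
  ext a b
  simp only [tensorAdjoint, Matrix.of_apply, lambdaTensor_apply, map_sum, tensorStar_smul,
    tensorStar_tprod, Matrix.conjTranspose_apply]
  rw [Finset.sum_comm]
  refine Finset.sum_congr rfl fun k _ => Finset.sum_congr rfl fun l _ => ?_
  rw [hO1 j hj k l, Matrix.conjTranspose_apply]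

end

/-! ### Block matrices -/

section Block

variable {E : Type*}

theorem exists_eq_block {n k : ℕ} (u : Matrix (Fin (n + k)) (Fin (n + k)) E) :
    ∃ a b c d, u = block a b c d := by
  refine ⟨((Matrix.reindex finSumFinEquiv finSumFinEquiv).symm u).toBlocks₁₁,
    ((Matrix.reindex finSumFinEquiv finSumFinEquiv).symm u).toBlocks₁₂,
    ((Matrix.reindex finSumFinEquiv finSumFinEquiv).symm u).toBlocks₂₁,
    ((Matrix.reindex finSumFinEquiv finSumFinEquiv).symm u).toBlocks₂₂, ?_⟩
  rw [block, Matrix.fromBlocks_toBlocks, Equiv.apply_symm_apply]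

theorem block_add [AddCommGroup E] {n k : ℕ} (a a' : Matrix (Fin n) (Fin n) E)
    (b b' : Matrix (Fin n) (Fin k) E)
    (c c' : Matrix (Fin k) (Fin n) E) (d d' : Matrix (Fin k) (Fin k) E) :
    block (a + a') (b + b') (c + c') (d + d') = block a b c d + block a' b' c' d' := by
  rw [block, ← Matrix.fromBlocks_add]
  rfl

theorem block_smul [AddCommGroup E] [Module ℂ E] {n k : ℕ} (x : ℂ)
    (a : Matrix (Fin n) (Fin n) E) (b : Matrix (Fin n) (Fin k) E)
    (c : Matrix (Fin k) (Fin n) E) (d : Matrix (Fin k) (Fin k) E) :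
    block (x • a) (x • b) (x • c) (x • d) = x • block a b c d := by
  rw [block, ← Matrix.fromBlocks_smul]
  rfl

theorem block_zero [AddCommGroup E] {n k : ℕ} : block (0 : Matrix (Fin n) (Fin n) E) 0 0
    (0 : Matrix (Fin k) (Fin k) E) = 0 := by
  rw [block, Matrix.fromBlocks_zero]
  rfl

theorem block_conjTranspose [AddCommGroup E] [StarAddMonoid E] {n k : ℕ}
    (a : Matrix (Fin n) (Fin n) E)
    (b : Matrix (Fin n) (Fin k) E) (c : Matrix (Fin k) (Fin n) E) (d : Matrix (Fin k) (Fin k) E) :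
    (block a b c d).conjTranspose =
      block a.conjTranspose c.conjTranspose b.conjTranspose d.conjTranspose := by
  rw [block, block, Matrix.conjTranspose_reindex, Matrix.fromBlocks_conjTranspose]

/-- A block matrix of products with scalar matrices. -/
theorem block_sandwich [AddCommGroup E] [Module ℂ E] {n k : ℕ} {κ₁ κ₂ : Type*} [Fintype κ₁] [Fintype κ₂]
    (α : Matrix (Fin n) κ₁ ℂ) (β : Matrix (Fin k) κ₂ ℂ) (a : Matrix κ₁ κ₁ E) (b : Matrix κ₁ κ₂ E)
    (c : Matrix κ₂ κ₁ E) (d : Matrix κ₂ κ₂ E) :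
    block (sandwich α a α.conjTranspose) (sandwich α b β.conjTranspose)
      (sandwich β c α.conjTranspose) (sandwich β d β.conjTranspose) =
    sandwich ((Matrix.fromBlocks α 0 0 β).submatrix finSumFinEquiv.symm id)
      (Matrix.fromBlocks a b c d)
      ((Matrix.fromBlocks α 0 0 β).submatrix finSumFinEquiv.symm id).conjTranspose := by
  rw [block, ← sandwich_fromBlocks_diag, reindex_sandwich, Matrix.conjTranspose_submatrix,
    Matrix.fromBlocks_conjTranspose, Matrix.conjTranspose_zero, Matrix.conjTranspose_zero]

/-- Multiplication of a block matrix with a scalar diagonal matrix from both sides. -/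
theorem exists_sandwich_block_eq (n k : ℕ) (s t : ℂ) :
    ∃ X : Matrix (Fin (n + k)) (Fin (n + k)) ℂ, ∀ {E : Type u} [AddCommGroup E] [Module ℂ E]
      (a : Matrix (Fin n) (Fin n) E) (b : Matrix (Fin n) (Fin k) E) (c : Matrix (Fin k) (Fin n) E)
      (d : Matrix (Fin k) (Fin k) E),
      sandwich X (block a b c d) X.conjTranspose =
        block ((star s * s) • a) ((star t * s) • b) ((star s * t) • c) ((star t * t) • d) := by
  refine ⟨(Matrix.fromBlocks (s • 1) 0 0 (t • 1)).submatrix finSumFinEquiv.symm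
    finSumFinEquiv.symm, fun {E} _ _ a b c d => ?_⟩
  have h := block_sandwich (s • (1 : Matrix (Fin n) (Fin n) ℂ)) (t • (1 : Matrix (Fin k) (Fin k) ℂ))
    a b c d
  simp only [Matrix.conjTranspose_smul, Matrix.conjTranspose_one, smul_sandwich,
    sandwich_smul_right, one_sandwich, smul_smul] at h
  rw [h]
  ext i j
  simp only [sandwich_apply, block]
  rw [← finSumFinEquiv.sum_comp]
  refine Finset.sum_congr rfl fun x _ => ?_
  rw [← finSumFinEquiv.sum_comp]
  simp

end Block

/-! ### Positive matrices -/

namespace MatrixOrderedOperatorSpace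

variable {V : Type u} [AddCommGroup V] [Module ℂ V] [StarAddMonoid V] [StarModule ℂ V]
  (O : MatrixOrderedOperatorSpace V)

theorem sandwich_conjTranspose_mem_pos {n k : ℕ} (A : Matrix (Fin k) (Fin n) ℂ)
    {v : Matrix (Fin n) (Fin n) V} (hv : v ∈ O.pos n) : sandwich A v A.conjTranspose ∈ O.pos k := by
  simpa using O.pos_sandwich A.conjTranspose v hv

theorem block_mem_pos {n k : ℕ} {v : Matrix (Fin n) (Fin n) V} {w : Matrix (Fin k) (Fin k) V}
    (hv : v ∈ O.pos n) (hw : w ∈ O.pos k) : block v 0 0 w ∈ O.pos (n + k) := by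
  -- The direct sum is the sum of the images of `v` and `w` under the two coordinate embeddings.
  have h := (O.pos_isCone (n + k)).add_mem _
    (O.sandwich_conjTranspose_mem_pos
      ((Matrix.fromRows 1 0).submatrix finSumFinEquiv.symm id) hv) _
    (O.sandwich_conjTranspose_mem_pos
      ((Matrix.fromRows 0 1).submatrix finSumFinEquiv.symm id) hw)
  convert h using 1
  ext i j
  obtain ⟨i, rfl⟩ := finSumFinEquiv.surjective i
  obtain ⟨j, rfl⟩ := finSumFinEquiv.surjective j
  rcases i with i | i <;> rcases j with j | j <;>
    simp [block, sandwich_apply, Matrix.one_apply, -finSumFinEquiv_apply_left,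
      -finSumFinEquiv_apply_right]

theorem smul_mem_pos {n : ℕ} {t : ℝ} (ht : 0 ≤ t) {v : Matrix (Fin n) (Fin n) V}
    (hv : v ∈ O.pos n) : (t : ℂ) • v ∈ O.pos n :=
  (O.pos_isCone n).smul_mem t ht v hv

/-- In a matrix regular operator space every matrix is the corner of a positive matrix. -/
theorem IsMatrixRegular.exists_block_mem_pos (hO : O.IsMatrixRegular) {j : ℕ} (hj : 0 < j)
    (v : Matrix (Fin j) (Fin j) V) :
    ∃ a ∈ O.pos j, ∃ d ∈ O.pos j, block a v v.conjTranspose d ∈ O.pos (j + j) := by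
  -- The self-adjoint matrix `x` is scaled into the unit ball by `c = ‖x‖ + 1`, which is positive
  -- even if `x = 0`; axiom (2) then gives `-cu ≤ x ≤ cu`.
  set x : Matrix (Fin (j + j)) (Fin (j + j)) V := block 0 v v.conjTranspose 0 with hx
  have hN := O.isNorm (j + j)
  set c : ℝ := O.mnorm x + 1
  have hc : 0 < c := by linarith [hN.nonneg x]
  have hc' : (c : ℂ) ≠ 0 := by exact_mod_cast hc.ne'
  have hxs : x.conjTranspose = x := by simp [hx, block_conjTranspose]
  obtain ⟨u, hu, -, h1, h2⟩ := hO.exists_bound (j + j) (by omega) (((c⁻¹ : ℝ) : ℂ) • x)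
    (by rw [Matrix.conjTranspose_smul, hxs]; simp)
    (by
      rw [hN.smul, Complex.norm_real, Real.norm_of_nonneg (by positivity)]
      rw [inv_mul_le_iff₀ hc]
      linarith)
  have h1' := O.smul_mem_pos hc.le h1
  have h2' := O.smul_mem_pos hc.le h2
  have hu' := O.smul_mem_pos hc.le hu
  rw [smul_add, smul_smul] at h1'
  rw [smul_sub, smul_smul] at h2'
  rw [Complex.ofReal_inv, mul_inv_cancel₀ hc', one_smul] at h1' h2'
  obtain ⟨a, b, b', d, hab⟩ := exists_eq_block ((c : ℂ) • u)
  rw [hab] at h1' h2' hu'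
  obtain ⟨X, hX⟩ := exists_sandwich_block_eq.{u} j j 1 (-1)
  -- Conjugating `cu - x` by `diag(1, -1)` flips the sign of its off-diagonal blocks. Averaging with
  -- `cu + x` then cancels the unknown blocks `b, b'` of `cu` and leaves `v, v*`.
  have h2'' : (block a (-b) (-b') d) + x ∈ O.pos (j + j) := by
    have := O.sandwich_conjTranspose_mem_pos X h2'
    rw [show block a b b' d - x = block a (b - v) (b' - v.conjTranspose) d by
      rw [sub_eq_iff_eq_add, hx, ← block_add]; simp, hX] at this
    convert this using 1
    rw [hx, ← block_add]
    simp [sub_eq_add_neg, add_comm]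
  have h3 := O.smul_mem_pos (t := 1 / 2) (by norm_num)
    ((O.pos_isCone _).add_mem _ h1' _ h2'')
  have h4 : block a v v.conjTranspose d ∈ O.pos (j + j) := by
    convert h3 using 1
    rw [hx, ← block_add, ← block_add, ← block_add, ← block_smul]
    congr 1 <;> ext p q <;> simp <;> module
  refine ⟨a, ?_, d, ?_, h4⟩
  · have := O.sandwich_conjTranspose_mem_pos
      ((1 : Matrix (Fin (j + j)) (Fin (j + j)) ℂ).submatrix
        (fun i => finSumFinEquiv (Sum.inl i)) id) h4
    rw [Matrix.conjTranspose_submatrix, Matrix.conjTranspose_one, sandwich_submatrix_one] at this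
    convert this using 1
    ext p q
    simp [block, -finSumFinEquiv_apply_left]
  · have := O.sandwich_conjTranspose_mem_pos
      ((1 : Matrix (Fin (j + j)) (Fin (j + j)) ℂ).submatrix
        (fun i => finSumFinEquiv (Sum.inr i)) id) h4
    rw [Matrix.conjTranspose_submatrix, Matrix.conjTranspose_one, sandwich_submatrix_one] at this
    convert this using 1
    ext p q
    simp [block, -finSumFinEquiv_apply_right]

end MatrixOrderedOperatorSpace

/-! ### The cones `𝒞_n` -/

section Cone

variable {m : ℕ} {V : Fin m → Type u} [∀ t, AddCommGroup (V t)] [∀ t, Module ℂ (V t)]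
  [∀ t, StarAddMonoid (V t)] [∀ t, StarModule ℂ (V t)]
  (O : ∀ t, MatrixOrderedOperatorSpace (V t)) (L : MatrixProducts m)

theorem sandwich_mem_lambdaCone {n k : ℕ} (X : Matrix (Fin k) (Fin n) ℂ)
    {u : Matrix (Fin n) (Fin n) (⨂[ℂ] t, V t)} (hu : u ∈ lambdaCone L O n) :
    sandwich X u X.conjTranspose ∈ lambdaCone L O k := by
  obtain ⟨j, hj, α, v, hv, rfl⟩ := hu
  refine ⟨j, hj, X * α, v, hv, ?_⟩
  rw [sandwich_sandwich, Matrix.conjTranspose_mul]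

theorem zero_mem_lambdaCone (n : ℕ) : 0 ∈ lambdaCone L O n :=
  ⟨1, one_pos, 0, 0, fun t => ((O t).pos_isCone 1).zero_mem, by rw [zero_sandwich]⟩

theorem smul_mem_lambdaCone {n : ℕ} {t : ℝ} (ht : 0 ≤ t)
    {u : Matrix (Fin n) (Fin n) (⨂[ℂ] t, V t)} (hu : u ∈ lambdaCone L O n) :
    (t : ℂ) • u ∈ lambdaCone L O n := by
  obtain ⟨j, hj, α, v, hv, rfl⟩ := hu
  -- The product `α · α*` is quadratic in `α`, hence the square root.
  refine ⟨j, hj, ((√t : ℝ) : ℂ) • α, v, hv, ?_⟩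
  rw [Matrix.conjTranspose_smul, smul_sandwich, sandwich_smul_right, smul_smul]
  congr 1
  rw [RCLike.star_def, Complex.conj_ofReal]
  exact_mod_cast (Real.mul_self_sqrt ht).symm

/-- Direct sums of positive matrices are positive, and (E2) compresses `⊗_λ` of direct sums to the
direct sum of the two values; the row `(α, β)` then adds them. -/
theorem add_mem_lambdaCone (hE2 : L.E2) {n : ℕ} {u w : Matrix (Fin n) (Fin n) (⨂[ℂ] t, V t)}
    (hu : u ∈ lambdaCone L O n) (hw : w ∈ lambdaCone L O n) : u + w ∈ lambdaCone L O n := by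
  obtain ⟨r, hr, α, v, hv, rfl⟩ := hu
  obtain ⟨s, hs, β, w, hw, rfl⟩ := hw
  obtain ⟨P, -, hP⟩ := hE2 r s hr hs
  refine ⟨r + s, by omega, Matrix.fromCols α β * P, fun t => block (v t) 0 0 (w t),
    fun t => (O t).block_mem_pos (hv t) (hw t), ?_⟩
  rw [Matrix.conjTranspose_mul, ← sandwich_sandwich, sandwich_lambdaTensor_diag L r s P hP,
    Matrix.conjTranspose_fromCols_eq_fromRows_conjTranspose,
    sandwich_fromCols_fromRows_fromBlocks, sandwich_zero, sandwich_zero, add_zero, zero_add]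

theorem sum_mem_lambdaCone (hE2 : L.E2) {n : ℕ} {σ : Type*} (s : Finset σ)
    (u : σ → Matrix (Fin n) (Fin n) (⨂[ℂ] t, V t)) (hu : ∀ x ∈ s, u x ∈ lambdaCone L O n) :
    ∑ x ∈ s, u x ∈ lambdaCone L O n :=
  Finset.sum_induction _ (· ∈ lambdaCone L O n) (fun _ _ => add_mem_lambdaCone O L hE2)
    (zero_mem_lambdaCone O L n) hu

theorem isCone_lambdaCone (hE2 : L.E2) (n : ℕ) : IsCone (lambdaCone L O n) where
  zero_mem := zero_mem_lambdaCone O L n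
  add_mem _ hx _ hy := add_mem_lambdaCone O L hE2 hx hy
  smul_mem _ ht _ hx := smul_mem_lambdaCone O L ht hx

theorem tensorAdjoint_eq_of_mem_lambdaCone (hO1 : L.O1) {n : ℕ}
    {u : Matrix (Fin n) (Fin n) (⨂[ℂ] t, V t)} (hu : u ∈ lambdaCone L O n) :
    tensorAdjoint u = u := by
  obtain ⟨j, hj, α, v, hv, rfl⟩ := hu
  rw [tensorAdjoint_sandwich, tensorAdjoint_lambdaTensor L hO1 j hj,
    Matrix.conjTranspose_conjTranspose]
  simp only [fun t => (O t).pos_selfAdjoint j (v t) (hv t)]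

/-- Every matrix over the tensor product is the corner of an element of the cone. -/
theorem exists_block_mem_lambdaCone (hm : 0 < m) (hO : ∀ t, (O t).IsMatrixRegular) (hE1 : L.E1)
    (hE2 : L.E2) (hO1 : L.O1) (hO2 : L.O2) {n : ℕ} (z : Matrix (Fin n) (Fin n) (⨂[ℂ] t, V t)) :
    ∃ u₁ ∈ lambdaCone L O n, ∃ u₂ ∈ lambdaCone L O n,
      block u₁ z (tensorAdjoint z) u₂ ∈ lambdaCone L O (n + n) := by
  obtain ⟨r, hr, α, v, β, rfl⟩ := exists_eq_sandwich_lambdaTensor L hm hE1 z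
  choose a ha d hd hW using fun t => (hO t).exists_block_mem_pos (O t) hr (v t)
  obtain ⟨P, -, hP, hP'⟩ := hO2 r hr
  refine ⟨sandwich α (lambdaTensor L r a) α.conjTranspose, ⟨r, hr, α, a, ha, rfl⟩,
    sandwich β.conjTranspose (lambdaTensor L r d) β.conjTranspose.conjTranspose,
    ⟨r, hr, β.conjTranspose, d, hd, rfl⟩, ?_⟩
  rw [tensorAdjoint_sandwich, tensorAdjoint_lambdaTensor L hO1 r hr]
  have h := block_sandwich α β.conjTranspose (lambdaTensor L r a) (lambdaTensor L r v)
    (lambdaTensor L r fun t => (v t).conjTranspose) (lambdaTensor L r d)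
  rw [Matrix.conjTranspose_conjTranspose] at h ⊢
  rw [h, ← sum_sandwich_lambdaTensor_sign L hm r P hP hP', sandwich_sum]
  refine sum_mem_lambdaCone O L hE2 _ _ fun s _ => ?_
  -- The product of signs is `±1`, so the weight is `2 / 2^m` or `0`: the average stays in the cone.
  have hsign : ∃ c : ℝ, 0 ≤ c ∧ (1 + ∏ t, boolSign (s t)) / 2 ^ m = (c : ℂ) := by
    have : ∏ t, boolSign (s t) = 1 ∨ ∏ t, boolSign (s t) = -1 := by
      refine Finset.prod_induction _ (fun x : ℂ => x = 1 ∨ x = -1) ?_ (Or.inl rfl) ?_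
      · rintro _ _ (rfl | rfl) (rfl | rfl) <;> simp
      · intro t _
        cases s t <;> simp [boolSign]
    rcases this with h | h
    · exact ⟨2 / 2 ^ m, by positivity, by rw [h]; push_cast; norm_num⟩
    · exact ⟨0, le_rfl, by rw [h]; simp⟩
  obtain ⟨c, hc, hcs⟩ := hsign
  rw [hcs, sandwich_smul]
  rw [sandwich_sandwich, ← Matrix.conjTranspose_mul]
  refine smul_mem_lambdaCone O L hc ⟨r + r, by omega, _,
    fun t => block (a t) (boolSign (s t) • v t) (boolSign (s t) • (v t).conjTranspose) (d t),
    fun t => ?_, rfl⟩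
  -- Changing the sign of the off-diagonal blocks is conjugation by `diag(1, ±1)`.
  obtain ⟨X, hX⟩ := exists_sandwich_block_eq.{u} r r 1 (boolSign (s t))
  have := (O t).sandwich_conjTranspose_mem_pos X (hW t)
  rw [hX] at this
  convert this using 2 <;> cases s t <;> simp [boolSign]

end Cone

/-! ### The norm of a row and of a column of two matrices -/

/-- By the C*-identity: for the column `X` of `A` and `B`, `X* X = A* A + B* B`. -/
theorem norm_fromRows_sq_le {κ κ₁ κ₂ : Type*} [Fintype κ] [DecidableEq κ] [Fintype κ₁]
    [Fintype κ₂] [DecidableEq κ₁] [DecidableEq κ₂] (A : Matrix κ₁ κ ℂ) (B : Matrix κ₂ κ ℂ) :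
    ‖Matrix.fromRows A B‖ ^ 2 ≤ ‖A‖ ^ 2 + ‖B‖ ^ 2 := by
  rw [sq, ← Matrix.l2_opNorm_conjTranspose_mul_self,
    Matrix.conjTranspose_fromRows_eq_fromCols_conjTranspose, Matrix.fromCols_mul_fromRows, sq, sq,
    ← Matrix.l2_opNorm_conjTranspose_mul_self, ← Matrix.l2_opNorm_conjTranspose_mul_self]
  exact norm_add_le _ _

theorem norm_fromCols_sq_le {κ κ₁ κ₂ : Type*} [Fintype κ] [DecidableEq κ] [Fintype κ₁]
    [Fintype κ₂] [DecidableEq κ₁] [DecidableEq κ₂] (A : Matrix κ κ₁ ℂ) (B : Matrix κ κ₂ ℂ) :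
    ‖Matrix.fromCols A B‖ ^ 2 ≤ ‖A‖ ^ 2 + ‖B‖ ^ 2 := by
  rw [← Matrix.l2_opNorm_conjTranspose, Matrix.conjTranspose_fromCols_eq_fromRows_conjTranspose,
    ← Matrix.l2_opNorm_conjTranspose A, ← Matrix.l2_opNorm_conjTranspose B]
  exact norm_fromRows_sq_le _ _

/-! ### The norm `‖·‖_λ` -/

section LambdaNorm

variable {m : ℕ} {V : Fin m → Type u} [∀ t, AddCommGroup (V t)] [∀ t, Module ℂ (V t)]
  (L : MatrixProducts m) (O : ∀ t, OperatorSpace (V t)) {n : ℕ}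

theorem lambdaNorm_nonneg (u : Matrix (Fin n) (Fin n) (⨂[ℂ] t, V t)) : 0 ≤ lambdaNorm L O u := by
  refine Real.sInf_nonneg ?_
  rintro _ ⟨j, -, α, v, β, -, rfl⟩
  have : 0 ≤ ∏ t, (O t).mnorm (v t) :=
    Finset.prod_nonneg fun t _ => ((O t).isNorm j).nonneg _
  positivity

theorem lambdaNorm_sandwich_le {j : ℕ} (hj : 0 < j) (α : Matrix (Fin n) (Fin (L.τ j)) ℂ)
    (v : ∀ t, Matrix (Fin j) (Fin j) (V t)) (β : Matrix (Fin (L.τ j)) (Fin n) ℂ) :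
    lambdaNorm L O (sandwich α (lambdaTensor L j v) β) ≤
      ‖α‖ * (∏ t, (O t).mnorm (v t)) * ‖β‖ := by
  refine csInf_le ⟨0, ?_⟩ ⟨j, hj, α, v, β, rfl, rfl⟩
  rintro _ ⟨j, -, α, v, β, -, rfl⟩
  have : 0 ≤ ∏ t, (O t).mnorm (v t) :=
    Finset.prod_nonneg fun t _ => ((O t).isNorm j).nonneg _
  positivity

theorem exists_lt_of_lambdaNorm_lt (hm : 0 < m) (hE1 : L.E1)
    {u : Matrix (Fin n) (Fin n) (⨂[ℂ] t, V t)} {δ : ℝ} (hδ : lambdaNorm L O u < δ) :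
    ∃ j : ℕ, 0 < j ∧ ∃ (α : Matrix (Fin n) (Fin (L.τ j)) ℂ)
      (v : ∀ t, Matrix (Fin j) (Fin j) (V t)) (β : Matrix (Fin (L.τ j)) (Fin n) ℂ),
      u = sandwich α (lambdaTensor L j v) β ∧ ‖α‖ * (∏ t, (O t).mnorm (v t)) * ‖β‖ < δ := by
  obtain ⟨c, ⟨j, hj, α, v, β, hu, rfl⟩, hc⟩ := exists_lt_of_csInf_lt (by
    obtain ⟨j, hj, α, v, β, hu⟩ := exists_eq_sandwich_lambdaTensor L hm hE1 u
    exact ⟨_, j, hj, α, v, β, hu, rfl⟩) hδ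
  exact ⟨j, hj, α, v, β, hu, hc⟩

theorem lambdaNorm_smul_le (hm : 0 < m) (hE1 : L.E1) (c : ℂ)
    (u : Matrix (Fin n) (Fin n) (⨂[ℂ] t, V t)) :
    lambdaNorm L O (c • u) ≤ ‖c‖ * lambdaNorm L O u := by
  refine le_of_forall_pos_le_add fun ε hε => ?_
  obtain ⟨j, hj, α, v, β, hu, hlt⟩ := exists_lt_of_lambdaNorm_lt L O hm hE1
    (show lambdaNorm L O u < lambdaNorm L O u + ε / (‖c‖ + 1) by
      have : 0 < ε / (‖c‖ + 1) := by positivity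
      linarith)
  calc lambdaNorm L O (c • u) ≤ ‖c • α‖ * (∏ t, (O t).mnorm (v t)) * ‖β‖ := by
        rw [hu, ← smul_sandwich]
        exact lambdaNorm_sandwich_le L O hj _ _ _
    _ = ‖c‖ * (‖α‖ * (∏ t, (O t).mnorm (v t)) * ‖β‖) := by rw [norm_smul]; ring
    _ ≤ ‖c‖ * (lambdaNorm L O u + ε / (‖c‖ + 1)) := by gcongr
    _ ≤ ‖c‖ * lambdaNorm L O u + ε := by
        rw [mul_add]
        gcongr
        rw [mul_div_assoc', div_le_iff₀ (by positivity)]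
        nlinarith [norm_nonneg c]

/-- A normalized decomposition. -/
theorem exists_normalized_of_lambdaNorm_lt (hm : 0 < m) (hE1 : L.E1)
    {u : Matrix (Fin n) (Fin n) (⨂[ℂ] t, V t)} {δ : ℝ} (hδ : lambdaNorm L O u < δ) :
    ∃ j : ℕ, 0 < j ∧ ∃ (α : Matrix (Fin n) (Fin (L.τ j)) ℂ)
      (v : ∀ t, Matrix (Fin j) (Fin j) (V t)) (β : Matrix (Fin (L.τ j)) (Fin n) ℂ),
      u = sandwich α (lambdaTensor L j v) β ∧ ‖α‖ ^ 2 ≤ δ ∧ (∀ t, (O t).mnorm (v t) ≤ 1) ∧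
        ‖β‖ ^ 2 ≤ δ := by
  have hδ0 : 0 < δ := (lambdaNorm_nonneg L O u).trans_lt hδ
  obtain ⟨j, hj, α, v, β, rfl, hlt⟩ := exists_lt_of_lambdaNorm_lt L O hm hE1 hδ
  have hv0 : ∀ t, 0 ≤ (O t).mnorm (v t) := fun t => ((O t).isNorm j).nonneg _
  -- If a factor has norm zero it cannot be normalized, but then `u = 0` and a zero decomposition
  -- serves.
  by_cases h0 : ‖α‖ * (∏ t, (O t).mnorm (v t)) * ‖β‖ = 0
  · refine ⟨1, one_pos, 0, 0, 0, ?_, by simpa using hδ0.le, fun t => ?_, by simpa using hδ0.le⟩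
    · rw [zero_sandwich]
      rcases mul_eq_zero.1 h0 with h | h
      · rcases mul_eq_zero.1 h with h | h
        · rw [norm_eq_zero.1 h, zero_sandwich]
        · obtain ⟨t, -, ht⟩ := Finset.prod_eq_zero_iff.1 h
          rw [lambdaTensor_eq_zero L j v t ((((O t).isNorm j).eq_zero_iff _).1 ht), sandwich_zero]
      · rw [norm_eq_zero.1 h, sandwich_zero_right]
    · rw [Pi.zero_apply, (((O t).isNorm 1).eq_zero_iff _).2 rfl]
      exact zero_le_one
  set N := ∏ t, (O t).mnorm (v t) with hN
  have hα : 0 < ‖α‖ := (norm_nonneg _).lt_of_ne fun h => h0 (by simp [← h])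
  have hβ : 0 < ‖β‖ := (norm_nonneg _).lt_of_ne fun h => h0 (by simp [← h])
  have hN0 : N ≠ 0 := fun h => h0 (by simp [h])
  have hNpos : 0 < N := (Finset.prod_nonneg fun t _ => hv0 t).lt_of_ne (Ne.symm hN0)
  have hvt : ∀ t, (O t).mnorm (v t) ≠ 0 := fun t => by
    intro h
    exact hN0 (Finset.prod_eq_zero (Finset.mem_univ t) h)
  -- These scalars equalize the outer factors, `‖sα‖² = ‖s'β‖² = N ‖α‖ ‖β‖`, while `s s' = N`
  -- compensates for dividing each `v_t` by its norm.
  set s : ℝ := √(N * ‖β‖ / ‖α‖)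
  set s' : ℝ := √(N * ‖α‖ / ‖β‖)
  have hs : s ^ 2 = N * ‖β‖ / ‖α‖ := Real.sq_sqrt (by positivity)
  have hs' : s' ^ 2 = N * ‖α‖ / ‖β‖ := Real.sq_sqrt (by positivity)
  have hss : s * s' = N := by
    rw [← Real.sqrt_mul (by positivity)]
    rw [show N * ‖β‖ / ‖α‖ * (N * ‖α‖ / ‖β‖) = N ^ 2 by field_simp]
    exact Real.sqrt_sq hNpos.le
  refine ⟨j, hj, (s : ℂ) • α, fun t => (((O t).mnorm (v t))⁻¹ : ℂ) • v t, (s' : ℂ) • β, ?_, ?_,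
    fun t => ?_, ?_⟩
  · rw [lambdaTensor_smul, smul_sandwich, sandwich_smul_right, sandwich_smul, smul_smul, smul_smul]
    have : (s : ℂ) * s' * ∏ t, (((O t).mnorm (v t))⁻¹ : ℂ) = 1 := by
      rw [Finset.prod_inv_distrib, ← Complex.ofReal_prod, ← hN, ← Complex.ofReal_mul,
        hss, mul_inv_cancel₀ (by exact_mod_cast hN0)]
    rw [this, one_smul]
  · rw [norm_smul, Complex.norm_real, mul_pow, Real.norm_eq_abs, sq_abs, hs]
    refine le_of_eq_of_le ?_ hlt.le
    field_simp
  · rw [((O t).isNorm j).smul, norm_inv, Complex.norm_real, Real.norm_of_nonneg (hv0 t),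
      inv_mul_cancel₀ (hvt t)]
  · rw [norm_smul, Complex.norm_real, mul_pow, Real.norm_eq_abs, sq_abs, hs']
    refine le_of_eq_of_le ?_ hlt.le
    field_simp

/-- Normalized decompositions are joined by (E2): the direct sums have norm at most `1` by Ruan's
axiom, and the squared norms of the joined outer factors add. The contraction `P` costs nothing. -/
theorem lambdaNorm_add_le (hm : 0 < m) (hE1 : L.E1) (hE2 : L.E2)
    (u w : Matrix (Fin n) (Fin n) (⨂[ℂ] t, V t)) :
    lambdaNorm L O (u + w) ≤ lambdaNorm L O u + lambdaNorm L O w := by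
  refine le_of_forall_pos_le_add fun ε hε => ?_
  obtain ⟨r, hr, α, v, β, hu, hα, hv, hβ⟩ := exists_normalized_of_lambdaNorm_lt L O hm hE1
    (show lambdaNorm L O u < lambdaNorm L O u + ε / 2 by linarith)
  obtain ⟨s, hs, α', v', β', hw, hα', hv', hβ'⟩ := exists_normalized_of_lambdaNorm_lt L O hm hE1
    (show lambdaNorm L O w < lambdaNorm L O w + ε / 2 by linarith)
  obtain ⟨P, hP1, hP⟩ := hE2 r s hr hs
  have huw : u + w = sandwich (Matrix.fromCols α α' * P)
      (lambdaTensor L (r + s) fun t => block (v t) 0 0 (v' t))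
      (P.conjTranspose * Matrix.fromRows β β') := by
    rw [← sandwich_sandwich, sandwich_lambdaTensor_diag L r s P hP,
      sandwich_fromCols_fromRows_fromBlocks, sandwich_zero, sandwich_zero, add_zero, zero_add,
      hu, hw]
  have hδ : 0 ≤ lambdaNorm L O u + lambdaNorm L O w + ε := by
    linarith [lambdaNorm_nonneg L O u, lambdaNorm_nonneg L O w]
  have hA : ‖Matrix.fromCols α α' * P‖ ≤ √(lambdaNorm L O u + lambdaNorm L O w + ε) := by
    refine (Matrix.l2_opNorm_mul _ _).trans ((mul_le_of_le_one_right (norm_nonneg _) hP1).trans ?_)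
    refine Real.le_sqrt_of_sq_le ((norm_fromCols_sq_le _ _).trans ?_)
    linarith
  have hB : ‖P.conjTranspose * Matrix.fromRows β β'‖ ≤
      √(lambdaNorm L O u + lambdaNorm L O w + ε) := by
    refine (Matrix.l2_opNorm_mul _ _).trans ((mul_le_of_le_one_left (norm_nonneg _)
      ((Matrix.l2_opNorm_conjTranspose _).trans_le hP1)).trans ?_)
    refine Real.le_sqrt_of_sq_le ((norm_fromRows_sq_le _ _).trans ?_)
    linarith
  have hV : ∏ t, (O t).mnorm (block (v t) 0 0 (v' t)) ≤ 1 := by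
    refine Finset.prod_le_one (fun t _ => ((O t).isNorm _).nonneg _) fun t _ => ?_
    rw [(O t).mnorm_diag]
    exact max_le (hv t) (hv' t)
  rw [huw]
  refine (lambdaNorm_sandwich_le L O (by omega) _ _ _).trans ?_
  calc _ ≤ √(lambdaNorm L O u + lambdaNorm L O w + ε) * 1 *
        √(lambdaNorm L O u + lambdaNorm L O w + ε) := by
        have : 0 ≤ ∏ t, (O t).mnorm (block (v t) 0 0 (v' t)) :=
          Finset.prod_nonneg fun t _ => ((O t).isNorm _).nonneg _
        gcongr
    _ = _ := by rw [mul_one, Real.mul_self_sqrt hδ]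

end LambdaNorm

/-! ### Bounded positive functionals -/

theorem norm_replicateCol_le {j : ℕ} (x : EuclideanSpace ℂ (Fin j)) :
    ‖Matrix.replicateCol (Fin 1) x.ofLp‖ ≤ ‖x‖ := by
  rw [Matrix.l2_opNorm_def]
  refine ContinuousLinearMap.opNorm_le_bound _ (norm_nonneg _) fun y => ?_
  have h : ((Matrix.toEuclideanLin (𝕜 := ℂ)).trans LinearMap.toContinuousLinearMap
      (Matrix.replicateCol (Fin 1) x.ofLp)) y = y.ofLp 0 • x := by
    ext i
    simp [Matrix.mulVec, dotProduct, mul_comm]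
  rw [h, norm_smul, mul_comm]
  gcongr
  exact PiLp.norm_apply_le y 0

/-- A complex linear functional that is positive on `V⁺` and bounded. -/
structure MatrixOrderedOperatorSpace.IsPositiveFunctional {V : Type u} [AddCommGroup V]
    [Module ℂ V] [StarAddMonoid V] [StarModule ℂ V] (O : MatrixOrderedOperatorSpace V)
    (φ : V →ₗ[ℂ] ℂ) : Prop where
  nonneg : ∀ v ∈ O.pos 1, 0 ≤ φ (v 0 0)
  map_star : ∀ x, φ (star x) = star (φ x)
  bounded : ∃ C : ℝ, 0 ≤ C ∧ ∀ v : Matrix (Fin 1) (Fin 1) V, ‖φ (v 0 0)‖ ≤ C * O.mnorm v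

/-- Separation of a point from a closed cone by a bounded functional, for a norm given as a
function. -/
theorem exists_separating_functional {V : Type u} [AddCommGroup V] [Module ℂ V] (p : V → ℝ)
    (hp : IsNorm p) (K : Set V) (hK : IsCone K)
    (hcl : ∀ v, (∀ ε : ℝ, 0 < ε → ∃ w ∈ K, p (v - w) < ε) → v ∈ K) (x : V) (hx : x ∉ K) :
    ∃ f : V →ₗ[ℝ] ℝ, (∀ v ∈ K, 0 ≤ f v) ∧ f x < 0 ∧ ∃ C : ℝ, 0 ≤ C ∧ ∀ v, |f v| ≤ C * p v := by
  let _ : Norm V := ⟨p⟩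
  have core : NormedSpace.Core ℂ V :=
    { norm_nonneg := hp.nonneg
      norm_smul := hp.smul
      norm_triangle := hp.add_le
      norm_eq_zero_iff := hp.eq_zero_iff }
  let _ : NormedAddCommGroup V := NormedAddCommGroup.ofCore core
  let _ : NormedSpace ℂ V := NormedSpace.ofCore core
  have hclosed : IsClosed K := by
    refine isClosed_of_closure_subset fun v hv => hcl v fun ε hε => ?_
    obtain ⟨w, hw, h⟩ := Metric.mem_closure_iff.1 hv ε hε
    exact ⟨w, hw, by rw [dist_eq_norm] at h; exact h⟩
  let C : ProperCone ℝ V :=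
    { carrier := K
      add_mem' := fun ha hb => hK.add_mem _ ha _ hb
      zero_mem' := hK.zero_mem
      smul_mem' := fun c v hv => by
        have := hK.smul_mem c.1 c.2 v hv
        rwa [Complex.coe_smul] at this
      isClosed' := hclosed }
  obtain ⟨f, hf, hfx⟩ := ProperCone.hyperplane_separation_point C (x₀ := x) hx
  exact ⟨f.toLinearMap, hf, hfx, ‖f‖, norm_nonneg _, fun v => f.le_opNorm v⟩

namespace MatrixOrderedOperatorSpace

variable {V : Type u} [AddCommGroup V] [Module ℂ V] [StarAddMonoid V] [StarModule ℂ V]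
  (O : MatrixOrderedOperatorSpace V)

/-- Axiom (1) of matrix regularity with `u = 0` forces `‖v‖ ≤ 0`. -/
theorem eq_zero_of_mem_pos_of_neg_mem_pos (hO : O.IsMatrixRegular) {n : ℕ} (hn : 0 < n)
    {v : Matrix (Fin n) (Fin n) V} (hv : v ∈ O.pos n) (hv' : -v ∈ O.pos n) : v = 0 := by
  have h := hO.mnorm_le n hn v 0 (O.pos_selfAdjoint n v hv) (O.pos_isCone n).zero_mem
    (by simpa using hv) (by simpa using hv')
  rw [((O.isNorm n).eq_zero_iff 0).2 rfl] at h
  exact ((O.isNorm n).eq_zero_iff v).1 (le_antisymm h ((O.isNorm n).nonneg v))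

/-- Bounded positive functionals separate the points of a matrix regular operator space. -/
theorem exists_isPositiveFunctional_ne_zero (hO : O.IsMatrixRegular) {x : V} (hx : x ≠ 0) :
    ∃ φ, O.IsPositiveFunctional φ ∧ φ x ≠ 0 := by
  let M : V → Matrix (Fin 1) (Fin 1) V := fun y => Matrix.of fun _ _ => y
  have hM : ∀ v : Matrix (Fin 1) (Fin 1) V, M (v 0 0) = v := by
    intro v
    ext i j
    fin_cases i; fin_cases j; rfl
  let p : V → ℝ := fun y => O.mnorm (M y)
  have hp : IsNorm p :=
    { nonneg := fun y => (O.isNorm 1).nonneg _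
      eq_zero_iff := fun y => ((O.isNorm 1).eq_zero_iff _).trans
        ⟨fun h => congrFun (congrFun h 0) 0, fun h => by subst h; rfl⟩
      smul := fun c y => (O.isNorm 1).smul c (M y)
      add_le := fun y z => (O.isNorm 1).add_le (M y) (M z) }
  let K : Set V := {y | M y ∈ O.pos 1}
  have hK : IsCone K :=
    { zero_mem := (O.pos_isCone 1).zero_mem
      add_mem := fun y hy z hz => (O.pos_isCone 1).add_mem _ hy _ hz
      smul_mem := fun t ht y hy => (O.pos_isCone 1).smul_mem t ht _ hy }
  have hcl : ∀ v, (∀ ε : ℝ, 0 < ε → ∃ w ∈ K, p (v - w) < ε) → v ∈ K := by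
    intro v hv
    refine O.pos_closed 1 _ fun ε hε => ?_
    obtain ⟨w, hw, h⟩ := hv ε hε
    exact ⟨M w, hw, h⟩
  have hKstar : ∀ y ∈ K, star y = y := fun y hy =>
    congrFun (congrFun (O.pos_selfAdjoint 1 _ hy) 0) 0
  have hpstar : ∀ y, p (star y) = p y := fun y => O.mnorm_conjTranspose (M y)
  -- the complex linear extension of a real functional on the self-adjoint part
  have key : ∀ y : V, star y = y → y ∉ K → ∃ φ, O.IsPositiveFunctional φ ∧ φ y ≠ 0 := by
    intro y hy hyK
    obtain ⟨f, hfK, hfy, C, hC, hfC⟩ := exists_separating_functional p hp K hK hcl y hyK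
    -- The separating `f` is only real linear. Its restriction to the self-adjoint part is
    -- complexified, which makes `φ` hermitian as well; the real and imaginary parts are contractive
    -- because the involution is isometric.
    let φ : V →ₗ[ℂ] ℂ :=
      { toFun := fun z => (f (realPart z : V) : ℂ) + Complex.I * (f (imaginaryPart z : V) : ℂ)
        map_add' := fun z w => by
          simp only [map_add, AddSubgroup.coe_add, Complex.ofReal_add]
          ring
        map_smul' := fun c z => by
          simp only [realPart_smul, imaginaryPart_smul, AddSubgroup.coe_sub, AddSubgroup.coe_add,
            selfAdjoint.val_smul, map_sub, map_add, map_smul, smul_eq_mul, RingHom.id_apply]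
          apply Complex.ext <;> simp }
    have hφ : ∀ z, φ z = (f (realPart z : V) : ℂ) + Complex.I * (f (imaginaryPart z : V) : ℂ) :=
      fun z => rfl
    have hφs : ∀ z, star z = z → φ z = f z := by
      intro z hz
      have hz' : IsSelfAdjoint z := hz
      rw [hφ, hz'.coe_realPart, hz'.imaginaryPart]
      simp
    have hpre : ∀ z, p (realPart z : V) ≤ p z := by
      intro z
      rw [realPart_apply_coe, ← Complex.coe_smul, hp.smul]
      have := hp.add_le z (star z)
      rw [hpstar] at this
      rw [Complex.norm_real, Real.norm_of_nonneg (by norm_num)]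
      linarith
    have hpim : ∀ z, p (imaginaryPart z : V) ≤ p z := by
      intro z
      have h := hpre (Complex.I • z)
      rw [realPart_I_smul, hp.smul, Complex.norm_I, one_mul, AddSubgroup.coe_neg,
        ← neg_one_smul ℂ, hp.smul] at h
      simpa using h
    refine ⟨φ, ⟨fun v hv => ?_, fun z => ?_, 2 * C, by positivity, fun v => ?_⟩, ?_⟩
    · have hvK : v 0 0 ∈ K := by
        change M (v 0 0) ∈ O.pos 1
        rwa [hM]
      rw [hφs _ (hKstar _ hvK)]
      exact_mod_cast hfK _ hvK
    · have h1 : (realPart (star z) : V) = realPart z := by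
        rw [realPart_apply_coe, realPart_apply_coe, star_star, add_comm]
      have h2 : (imaginaryPart (star z) : V) = -imaginaryPart z := by
        rw [imaginaryPart_apply_coe, imaginaryPart_apply_coe, star_star, ← neg_sub, smul_neg,
          smul_neg]
      rw [hφ, hφ, h1, h2, map_neg]
      simp
    · have hv : p (v 0 0) = O.mnorm v := congrArg O.mnorm (hM v)
      rw [hφ, ← hv]
      refine (norm_add_le _ _).trans ?_
      rw [norm_mul, Complex.norm_I, one_mul, Complex.norm_real, Complex.norm_real,
        Real.norm_eq_abs, Real.norm_eq_abs]
      have h1 := (hfC (realPart (v 0 0))).trans (mul_le_mul_of_nonneg_left (hpre _) hC)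
      have h2 := (hfC (imaginaryPart (v 0 0))).trans (mul_le_mul_of_nonneg_left (hpim _) hC)
      linarith
    · rw [hφs y hy]
      exact_mod_cast hfy.ne
  have key' : ∀ y : V, star y = y → y ≠ 0 → ∃ φ, O.IsPositiveFunctional φ ∧ φ y ≠ 0 := by
    intro y hy hy0
    -- A nonzero self-adjoint `y` and its negative cannot both be positive, so one of them can be
    -- separated from `K`.
    by_cases hyK : y ∈ K
    · have hyK' : -y ∉ K := by
        intro h
        exact hy0 (congrFun (congrFun (O.eq_zero_of_mem_pos_of_neg_mem_pos hO one_pos hyK h) 0) 0)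
      obtain ⟨φ, h1, h2⟩ := key (-y) (by rw [star_neg, hy]) hyK'
      exact ⟨φ, h1, fun h => h2 (by rw [map_neg, h, neg_zero])⟩
    · exact key y hy hyK
  have hdec : ∀ φ, O.IsPositiveFunctional φ → φ x = 0 →
      φ (realPart x : V) = 0 ∧ φ (imaginaryPart x : V) = 0 := by
    intro φ hφ h
    have h' : φ (star x) = 0 := by rw [hφ.map_star, h, star_zero]
    constructor
    · rw [realPart_apply_coe, ← Complex.coe_smul, map_smul, map_add, h, h', add_zero, smul_zero]
    · rw [imaginaryPart_apply_coe, ← Complex.coe_smul, map_smul, map_smul, map_sub, h, h',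
        sub_zero, smul_zero, smul_zero]
  by_cases hre : (realPart x : V) = 0
  · have him : (imaginaryPart x : V) ≠ 0 := by
      intro him
      apply hx
      rw [← realPart_add_I_smul_imaginaryPart x, hre, him, smul_zero, add_zero]
    obtain ⟨φ, h1, h2⟩ := key' _ (imaginaryPart x).2 him
    exact ⟨φ, h1, fun h => h2 (hdec φ h1 h).2⟩
  · obtain ⟨φ, h1, h2⟩ := key' _ (realPart x).2 hre
    exact ⟨φ, h1, fun h => h2 (hdec φ h1 h).1⟩

/-- A positive functional maps positive matrices to positive semidefinite matrices. -/
theorem IsPositiveFunctional.posSemidef_map {O : MatrixOrderedOperatorSpace V} {φ : V →ₗ[ℂ] ℂ}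
    (hφ : O.IsPositiveFunctional φ) {j : ℕ} {v : Matrix (Fin j) (Fin j) V} (hv : v ∈ O.pos j) :
    (v.map φ).PosSemidef := by
  rw [Matrix.posSemidef_iff_dotProduct_mulVec]
  refine ⟨?_, fun x => ?_⟩
  · ext i k
    rw [Matrix.conjTranspose_apply, Matrix.map_apply, Matrix.map_apply, ← hφ.map_star,
      ← Matrix.conjTranspose_apply, O.pos_selfAdjoint j v hv]
  · have h := hφ.nonneg _ (O.pos_sandwich (Matrix.replicateCol (Fin 1) x) v hv)
    have h' := congrFun (congrFun (sandwich_map φ (Matrix.replicateCol (Fin 1) x).conjTranspose v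
      (Matrix.replicateCol (Fin 1) x)) 0) 0
    rw [Matrix.map_apply] at h'
    rw [h'] at h
    convert h using 1
    rw [Matrix.mul_assoc]
    rfl

/-- A bounded functional is completely bounded. -/
theorem IsPositiveFunctional.exists_norm_map_le {O : MatrixOrderedOperatorSpace V}
    {φ : V →ₗ[ℂ] ℂ} (hφ : O.IsPositiveFunctional φ) :
    ∃ C : ℝ, 0 ≤ C ∧ ∀ (j : ℕ) (v : Matrix (Fin j) (Fin j) V), ‖v.map φ‖ ≤ C * O.mnorm v := by
  obtain ⟨C, hC, h⟩ := hφ.bounded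
  refine ⟨C, hC, fun j v => ?_⟩
  have hv := (O.isNorm j).nonneg v
  rw [Matrix.l2_opNorm_def]
  refine ContinuousLinearMap.opNorm_le_bound _ (by positivity) fun x => ?_
  set y := ((Matrix.toEuclideanLin (𝕜 := ℂ)).trans LinearMap.toContinuousLinearMap (v.map φ)) x
  have hy : y.ofLp = (v.map φ).mulVec x.ofLp := rfl
  -- Testing against `y = φ(v) x` itself gives `φ(y* v x) = ‖y‖²`. Ruan's axiom bounds this by `C
  -- ‖y‖ ‖v‖ ‖x‖`, and one factor `‖y‖` cancels.
  have h1 : ‖φ (sandwich (Matrix.replicateCol (Fin 1) y.ofLp).conjTranspose v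
      (Matrix.replicateCol (Fin 1) x.ofLp) 0 0)‖ = ‖y‖ ^ 2 := by
    rw [← Matrix.map_apply (f := φ), sandwich_map, Matrix.mul_assoc]
    change ‖star y.ofLp ⬝ᵥ (v.map φ).mulVec x.ofLp‖ = _
    rw [← hy, dotProduct_comm, ← EuclideanSpace.inner_eq_star_dotProduct, inner_self_eq_norm_sq_to_K]
    simp
  have h2 : ‖y‖ ^ 2 ≤ ‖y‖ * (C * O.mnorm v * ‖x‖) := by
    rw [← h1]
    calc _ ≤ C * (‖(Matrix.replicateCol (Fin 1) y.ofLp).conjTranspose‖ * O.mnorm v *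
          ‖Matrix.replicateCol (Fin 1) x.ofLp‖) :=
          (h _).trans (mul_le_mul_of_nonneg_left (O.mnorm_sandwich_le _ _ _) hC)
      _ ≤ C * (‖y‖ * O.mnorm v * ‖x‖) := by
          rw [Matrix.l2_opNorm_conjTranspose]
          gcongr
          · exact norm_replicateCol_le y
          · exact norm_replicateCol_le x
      _ = _ := by ring
  rcases (norm_nonneg y).eq_or_lt with h0 | h0
  · rw [← h0]
    positivity
  · rw [sq] at h2
    exact le_of_mul_le_mul_left h2 h0

end MatrixOrderedOperatorSpace

/-! ### Product functionals -/

/-- A separating set of functionals contains coordinate functionals for every finite-dimensional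
subspace. -/
theorem exists_dual_system {V : Type u} [AddCommGroup V] [Module ℂ V] (S : Set (V →ₗ[ℂ] ℂ))
    (hS : ∀ x : V, x ≠ 0 → ∃ φ ∈ S, φ x ≠ 0) (F : Submodule ℂ V) [FiniteDimensional ℂ F] :
    ∃ (k : ℕ) (φ : Fin k → V →ₗ[ℂ] ℂ) (b : Fin k → V), (∀ i, φ i ∈ S) ∧
      ∀ x ∈ F, x = ∑ i, φ i x • b i := by
  let S' : Set (Module.Dual ℂ F) := (fun φ : V →ₗ[ℂ] ℂ => φ.comp F.subtype) '' S
  -- Separation means that no nonzero vector of `F` is annihilated by `S'`; in finite dimension `S'`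
  -- then spans the dual. A basis is chosen inside `S'`, and the `b i` form the basis of `F` dual to
  -- it.
  have hspan : ⊤ ≤ Submodule.span ℂ S' := by
    have h0 : (Submodule.span ℂ S').dualCoannihilator = ⊥ := by
      rw [eq_bot_iff]
      intro x hx
      by_contra hx0
      obtain ⟨φ, hφ, h⟩ := hS (x : V) fun h => hx0 (by simpa using h)
      exact h ((Submodule.mem_dualCoannihilator _).1 hx _
        (Submodule.subset_span ⟨φ, hφ, rfl⟩))
    rw [← Subspace.dualCoannihilator_dualAnnihilator_eq (W := Submodule.span ℂ S'), h0,
      Submodule.dualAnnihilator_bot]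
  let B := Module.Basis.ofSpan hspan
  have hB : ∀ i, B i ∈ S' := fun i => Module.Basis.ofSpan_subset hspan ⟨i, rfl⟩
  have : Finite _ := Module.Finite.finite_basis B
  let e := Finite.equivFin ((linearIndepOn_empty ℂ (id : Module.Dual ℂ F → _)).extend
    (Set.empty_subset S'))
  let B' := B.reindex e
  have hB' : ∀ i, ∃ φ ∈ S, φ.comp F.subtype = B' i := fun i => by
    rw [Module.Basis.reindex_apply]
    exact hB _
  choose φ hφ hφB using hB'
  let b : Fin _ → F := fun i => (Module.evalEquiv ℂ F).symm (B'.dualBasis i)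
  refine ⟨_, φ, fun i => b i, hφ, fun x hx => ?_⟩
  have h : (⟨x, hx⟩ : F) = ∑ i, φ i x • b i := by
    apply (Module.evalEquiv ℂ F).injective
    refine B'.ext fun j => ?_
    simp only [map_sum, map_smul, b, LinearEquiv.apply_symm_apply, LinearMap.sum_apply,
      LinearMap.smul_apply, Module.evalEquiv_apply]
    rw [Finset.sum_eq_single j (fun i _ hij => ?_) (fun h => absurd (Finset.mem_univ j) h)]
    · rw [Module.Basis.dualBasis_apply_self, if_pos rfl, ← hφB j]
      simp
    · rw [Module.Basis.dualBasis_apply_self, if_neg hij.symm, smul_zero]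
  simpa using congrArg (Subtype.val) h

section

variable {m : ℕ} {V : Fin m → Type u} [∀ t, AddCommGroup (V t)] [∀ t, Module ℂ (V t)]

/-- The functional `φ_1 ⊗ ⋯ ⊗ φ_m`. -/
noncomputable def productFunctional (φ : ∀ t, V t →ₗ[ℂ] ℂ) : (⨂[ℂ] t, V t) →ₗ[ℂ] ℂ :=
  PiTensorProduct.lift ((MultilinearMap.mkPiAlgebra ℂ (Fin m) ℂ).compLinearMap φ)

theorem productFunctional_tprod (φ : ∀ t, V t →ₗ[ℂ] ℂ) (x : ∀ t, V t) :
    productFunctional φ (PiTensorProduct.tprod ℂ x) = ∏ t, φ t (x t) := by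
  simp [productFunctional]

/-- Products of functionals from separating sets separate the points of the tensor product. -/
theorem eq_zero_of_productFunctional_eq_zero (S : ∀ t, Set (V t →ₗ[ℂ] ℂ))
    (hS : ∀ t (x : V t), x ≠ 0 → ∃ φ ∈ S t, φ x ≠ 0) (z : ⨂[ℂ] t, V t)
    (hz : ∀ φ : ∀ t, V t →ₗ[ℂ] ℂ, (∀ t, φ t ∈ S t) → productFunctional φ z = 0) : z = 0 := by
  classical
  -- The tensor `z` involves only finite-dimensional subspaces. Expressing this through operators
  -- that fix them avoids embedding the tensor product of the subspaces.
  have hF : ∃ F : ∀ t, Submodule ℂ (V t), (∀ t, FiniteDimensional ℂ (F t)) ∧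
      ∀ T : ∀ t, V t →ₗ[ℂ] V t, (∀ t, ∀ x ∈ F t, T t x = x) → PiTensorProduct.map T z = z := by
    clear hz
    induction z using PiTensorProduct.induction_on with
    | smul_tprod c f =>
      refine ⟨fun t => Submodule.span ℂ {f t}, fun t => inferInstance, fun T hT => ?_⟩
      rw [map_smul, PiTensorProduct.map_tprod]
      congr 2
      funext t
      exact hT t _ (Submodule.mem_span_singleton_self _)
    | add x y hx hy =>
      obtain ⟨F, hF, h⟩ := hx
      obtain ⟨F', hF', h'⟩ := hy
      refine ⟨fun t => F t ⊔ F' t, fun t => inferInstance, fun T hT => ?_⟩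
      rw [map_add, h T fun t x hx => hT t x (Submodule.mem_sup_left hx),
        h' T fun t x hx => hT t x (Submodule.mem_sup_right hx)]
  obtain ⟨F, hFd, hF⟩ := hF
  choose k φ b hφ hb using fun t => exists_dual_system (S t) (hS t) (F t)
  -- These finite-rank operators fix `F t`, so their tensor product fixes `z`. It expands into terms
  -- that factor through product functionals of members of the sets `S t`.
  let T : ∀ t, V t →ₗ[ℂ] V t := fun t => ∑ i, (φ t i).smulRight (b t i)
  have hT : PiTensorProduct.map T = ∑ s : ∀ t, Fin (k t),
      (productFunctional fun t => φ t (s t)).smulRight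
        (PiTensorProduct.tprod ℂ fun t => b t (s t)) := by
    ext x
    simp [T, PiTensorProduct.map_tprod, LinearMap.sum_apply, MultilinearMap.map_sum,
      MultilinearMap.map_smul_univ, productFunctional_tprod]
  rw [← hF T fun t x hx => by simpa [T, LinearMap.sum_apply] using (hb t x hx).symm, hT]
  simp only [LinearMap.sum_apply, LinearMap.smulRight_apply]
  refine Finset.sum_eq_zero fun s _ => ?_
  rw [hz _ fun t => hφ t (s t), zero_smul]

/-! ### Positivity and boundedness of product functionals -/

variable (L : MatrixProducts m)

theorem lambdaTensor_map_productFunctional (φ : ∀ t, V t →ₗ[ℂ] ℂ) (j : ℕ)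
    (v : ∀ t, Matrix (Fin j) (Fin j) (V t)) :
    (lambdaTensor L j v).map (productFunctional φ) = L.prod j fun t => (v t).map (φ t) := by
  rw [prod_eq_sum_single]
  ext a b
  simp [lambdaTensor_apply, Matrix.sum_apply, productFunctional_tprod, mul_comm]

/-- The case `p_1 = ⋯ = p_m = 1` of (O3), in which the Kronecker factors are scalars. -/
theorem posSemidef_prod (hO3 : L.O3) {r : ℕ} (hr : 0 < r) (x : Fin m → Matrix (Fin r) (Fin r) ℂ)
    (hx : ∀ t, (x t).PosSemidef) : (L.prod r x).PosSemidef := by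
  have h := (hO3 r hr (fun _ => 1) (fun _ => one_pos) (fun t => (x t).submatrix Prod.fst Prod.fst)
    fun t => (hx t).submatrix _).submatrix fun a : Fin (L.τ r) => (a, fun _ => (0 : Fin 1))
  convert h using 1
  rw [prod_eq_sum_single]
  ext a b
  simp [MatrixProducts.tensorKronecker, Matrix.sum_apply, mul_comm]

variable [∀ t, StarAddMonoid (V t)] [∀ t, StarModule ℂ (V t)]
  (O : ∀ t, MatrixOrderedOperatorSpace (V t))

theorem posSemidef_map_productFunctional (hO3 : L.O3) {φ : ∀ t, V t →ₗ[ℂ] ℂ}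
    (hφ : ∀ t, (O t).IsPositiveFunctional (φ t)) {n : ℕ}
    {u : Matrix (Fin n) (Fin n) (⨂[ℂ] t, V t)} (hu : u ∈ lambdaCone L O n) :
    (u.map (productFunctional φ)).PosSemidef := by
  obtain ⟨j, hj, α, v, hv, rfl⟩ := hu
  rw [sandwich_map, lambdaTensor_map_productFunctional]
  exact (posSemidef_prod L hO3 hj _ fun t => (hφ t).posSemidef_map (hv t)).mul_mul_conjTranspose_same
    α

/-- On a decomposition the product functional gives `α λ_j(φ_1(v_1), …, φ_m(v_m)) β`. The bound on
`λ_j` in (E3), uniform in `j`, and complete boundedness of each `φ_t` estimate it by a constant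
times the cost of the decomposition. -/
theorem exists_norm_map_productFunctional_le (hm : 0 < m) (hE1 : L.E1) (hE3 : L.E3)
    {φ : ∀ t, V t →ₗ[ℂ] ℂ} (hφ : ∀ t, (O t).IsPositiveFunctional (φ t)) :
    ∃ K : ℝ, 0 ≤ K ∧ ∀ (n : ℕ) (u : Matrix (Fin n) (Fin n) (⨂[ℂ] t, V t)),
      ‖u.map (productFunctional φ)‖ ≤ K * lambdaNorm L (fun t => (O t).toOperatorSpace) u := by
  obtain ⟨-, K, hK⟩ := hE3
  choose C hC hCφ using fun t => (hφ t).exists_norm_map_le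
  have hCp : 0 ≤ ∏ t, C t := Finset.prod_nonneg fun t _ => hC t
  refine ⟨|K| * ∏ t, C t, by positivity, fun n u => ?_⟩
  refine le_of_forall_pos_le_add fun ε hε => ?_
  set K' := |K| * ∏ t, C t
  have hK' : 0 ≤ K' := by positivity
  obtain ⟨j, hj, α, v, β, rfl, hlt⟩ := exists_lt_of_lambdaNorm_lt L
    (fun t => (O t).toOperatorSpace) hm hE1 (lt_add_of_pos_right _
      (show 0 < ε / (K' + 1) by positivity) : lambdaNorm L _ u < _)
  rw [sandwich_map, lambdaTensor_map_productFunctional]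
  have hprod : ‖L.prod j fun t => (v t).map (φ t)‖ ≤ K' * ∏ t, (O t).mnorm (v t) :=
    calc _ ≤ K * ∏ t, ‖(v t).map (φ t)‖ := hK j hj _
      _ ≤ |K| * ∏ t, (C t * (O t).mnorm (v t)) := by
        refine mul_le_mul (le_abs_self K) ?_ ?_ (abs_nonneg K)
        · exact Finset.prod_le_prod (fun t _ => norm_nonneg ((v t).map (φ t)))
            fun t _ => hCφ t j (v t)
        · exact Finset.prod_nonneg fun t _ => norm_nonneg ((v t).map (φ t))
      _ = _ := by rw [Finset.prod_mul_distrib, mul_assoc]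
  calc _ ≤ ‖α‖ * ‖L.prod j fun t => (v t).map (φ t)‖ * ‖β‖ :=
        (Matrix.l2_opNorm_mul _ _).trans
          (mul_le_mul_of_nonneg_right (Matrix.l2_opNorm_mul _ _) (norm_nonneg _))
    _ ≤ ‖α‖ * (K' * ∏ t, (O t).mnorm (v t)) * ‖β‖ := by gcongr
    _ = K' * (‖α‖ * (∏ t, (O t).mnorm (v t)) * ‖β‖) := by ring
    _ ≤ K' * (lambdaNorm L (fun t => (O t).toOperatorSpace)
          (sandwich α (lambdaTensor L j v) β) + ε / (K' + 1)) := by gcongr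
    _ ≤ _ := by
        rw [mul_add]
        gcongr
        rw [mul_div_assoc', div_le_iff₀ (by positivity)]
        nlinarith

/-- Products of positive functionals separate the matrices over the tensor product. -/
theorem eq_zero_of_map_productFunctional_eq_zero (hO : ∀ t, (O t).IsMatrixRegular) {n : ℕ}
    {z : Matrix (Fin n) (Fin n) (⨂[ℂ] t, V t)}
    (hz : ∀ φ : ∀ t, V t →ₗ[ℂ] ℂ, (∀ t, (O t).IsPositiveFunctional (φ t)) →
      z.map (productFunctional φ) = 0) : z = 0 := by
  ext i j
  refine eq_zero_of_productFunctional_eq_zero (fun t => {φ | (O t).IsPositiveFunctional φ})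
    (fun t x hx => (O t).exists_isPositiveFunctional_ne_zero (hO t) hx) _ fun φ hφ => ?_
  exact congrFun (congrFun (hz φ hφ) i) j

theorem isProperCone_lambdaCone (hO : ∀ t, (O t).IsMatrixRegular) (hE2 : L.E2) (hO3 : L.O3)
    (n : ℕ) : IsProperCone (lambdaCone L O n) where
  toIsCone := isCone_lambdaCone O L hE2 n
  eq_zero_of_neg_mem u hu hu' := by
    refine eq_zero_of_map_productFunctional_eq_zero O hO fun φ hφ => ?_
    have h1 := posSemidef_map_productFunctional L O hO3 hφ hu
    have h2 := posSemidef_map_productFunctional L O hO3 hφ hu'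
    have h3 : (-u).map (productFunctional φ) = -u.map (productFunctional φ) := by
      ext i j
      simp
    rw [h3] at h2
    open scoped MatrixOrder in
    exact le_antisymm (neg_nonneg.1 (Matrix.nonneg_iff_posSemidef.2 h2))
      (Matrix.nonneg_iff_posSemidef.2 h1)

end

/-! ### The norm `‖·‖_Λ` -/

theorem norm_entry_le {n k : ℕ} (A : Matrix (Fin n) (Fin k) ℂ) (i : Fin n) (j : Fin k) :
    ‖A i j‖ ≤ ‖A‖ := by
  have h := Matrix.l2_opNorm_mulVec A (EuclideanSpace.single j 1)
  rw [PiLp.norm_single, norm_one, mul_one] at h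
  refine le_trans ?_ ((PiLp.norm_apply_le _ i).trans h)
  simp

/-- The entries of an off-diagonal block of a positive semidefinite matrix. -/
theorem norm_entry_sq_le_of_posSemidef_block {n : ℕ} {a b c d : Matrix (Fin n) (Fin n) ℂ}
    (h : (block a b c d).PosSemidef) (i j : Fin n) : ‖b i j‖ ^ 2 ≤ ‖a‖ * ‖d‖ := by
  -- The `2 × 2` principal minor on row `i` of the first block and row `j` of the second is
  -- non-negative.
  have h1 := h.submatrix ![finSumFinEquiv (Sum.inl i), finSumFinEquiv (Sum.inr j)]
  have hdet := h1.det_nonneg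
  have hherm : c j i = star (b i j) := by
    have := h.1.apply (finSumFinEquiv (Sum.inr j)) (finSumFinEquiv (Sum.inl i))
    simpa [block, -finSumFinEquiv_apply_left, -finSumFinEquiv_apply_right] using this.symm
  rw [Matrix.det_fin_two] at hdet
  simp only [block, Matrix.submatrix_apply, Matrix.cons_val_zero, Matrix.cons_val_one,
    Matrix.reindex_apply, Equiv.symm_apply_apply, Matrix.fromBlocks_apply₁₁,
    Matrix.fromBlocks_apply₁₂, Matrix.fromBlocks_apply₂₁, Matrix.fromBlocks_apply₂₂, hherm,
    sub_nonneg] at hdet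
  have h2 : b i j * star (b i j) = ((‖b i j‖ ^ 2 : ℝ) : ℂ) := by
    rw [RCLike.star_def, Complex.mul_conj, Complex.normSq_eq_norm_sq]
  rw [h2] at hdet
  have h3 := (Complex.le_def.1 hdet).1.trans (Complex.re_le_norm _)
  rw [Complex.ofReal_re, norm_mul] at h3
  exact h3.trans (mul_le_mul (norm_entry_le a i i) (norm_entry_le d j j) (norm_nonneg _)
    (norm_nonneg _))

section BigLambdaNorm

variable {m : ℕ} {V : Fin m → Type u} [∀ t, AddCommGroup (V t)] [∀ t, Module ℂ (V t)]
  [∀ t, StarAddMonoid (V t)] [∀ t, StarModule ℂ (V t)] (L : MatrixProducts m)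
  (O : ∀ t, MatrixOrderedOperatorSpace (V t)) {n : ℕ}

theorem bigLambdaNorm_nonneg (z : Matrix (Fin n) (Fin n) (⨂[ℂ] t, V t)) :
    0 ≤ bigLambdaNorm L O z := by
  refine Real.sInf_nonneg ?_
  rintro _ ⟨w, w', -, rfl⟩
  exact le_max_of_le_left (lambdaNorm_nonneg L _ w)

theorem bigLambdaNorm_le {w z w' : Matrix (Fin n) (Fin n) (⨂[ℂ] t, V t)}
    (h : block w z (tensorAdjoint z) w' ∈ lambdaCone L O (n + n)) :
    bigLambdaNorm L O z ≤ max (lambdaNorm L (fun t => (O t).toOperatorSpace) w)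
      (lambdaNorm L (fun t => (O t).toOperatorSpace) w') := by
  refine csInf_le ⟨0, ?_⟩ ⟨w, w', h, rfl⟩
  rintro _ ⟨w, w', -, rfl⟩
  exact le_max_of_le_left (lambdaNorm_nonneg L _ w)

theorem exists_lt_of_bigLambdaNorm_lt (hm : 0 < m) (hO : ∀ t, (O t).IsMatrixRegular)
    (hE1 : L.E1) (hE2 : L.E2) (hO1 : L.O1) (hO2 : L.O2)
    {z : Matrix (Fin n) (Fin n) (⨂[ℂ] t, V t)} {δ : ℝ} (hδ : bigLambdaNorm L O z < δ) :
    ∃ w w' : Matrix (Fin n) (Fin n) (⨂[ℂ] t, V t),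
      block w z (tensorAdjoint z) w' ∈ lambdaCone L O (n + n) ∧
      lambdaNorm L (fun t => (O t).toOperatorSpace) w < δ ∧
      lambdaNorm L (fun t => (O t).toOperatorSpace) w' < δ := by
  obtain ⟨c, ⟨w, w', h, rfl⟩, hc⟩ := exists_lt_of_csInf_lt (by
    obtain ⟨w, -, w', -, h⟩ := exists_block_mem_lambdaCone O L hm hO hE1 hE2 hO1 hO2 z
    exact ⟨_, w, w', h, rfl⟩) hδ
  exact ⟨w, w', h, (le_max_left _ _).trans_lt hc, (le_max_right _ _).trans_lt hc⟩

theorem bigLambdaNorm_smul_le (hm : 0 < m) (hO : ∀ t, (O t).IsMatrixRegular)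
    (hE1 : L.E1) (hE2 : L.E2) (hO1 : L.O1) (hO2 : L.O2) (c : ℂ)
    (z : Matrix (Fin n) (Fin n) (⨂[ℂ] t, V t)) :
    bigLambdaNorm L O (c • z) ≤ ‖c‖ * bigLambdaNorm L O z := by
  rcases eq_or_ne c 0 with rfl | hc
  · rw [zero_smul, norm_zero, zero_mul]
    refine (bigLambdaNorm_le L O (w := 0) (w' := 0) ?_).trans ?_
    · rw [tensorAdjoint_zero, block_zero]
      exact zero_mem_lambdaCone O L _
    · have h := lambdaNorm_smul_le L (fun t => (O t).toOperatorSpace) hm hE1 0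
        (0 : Matrix (Fin n) (Fin n) (⨂[ℂ] t, V t))
      rw [zero_smul, norm_zero, zero_mul] at h
      exact max_le h h
  have hc0 : 0 < ‖c‖ := norm_pos_iff.2 hc
  refine le_of_forall_pos_le_add fun ε hε => ?_
  obtain ⟨w, w', h, hw, hw'⟩ := exists_lt_of_bigLambdaNorm_lt L O hm hO hE1 hE2 hO1 hO2
    (show bigLambdaNorm L O z < bigLambdaNorm L O z + ε / ‖c‖ by
      have : 0 < ε / ‖c‖ := by positivity
      linarith)
  -- the scalars on the diagonal
  set s : ℝ := √‖c‖
  have hs : (s : ℂ) * s = (‖c‖ : ℂ) := by exact_mod_cast Real.mul_self_sqrt hc0.le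
  have hs0 : (s : ℂ) ≠ 0 := by
    intro h
    rw [h, zero_mul] at hs
    exact hc0.ne (by exact_mod_cast hs)
  have hcc : star c * c = (‖c‖ : ℂ) * ‖c‖ := by
    rw [RCLike.star_def, mul_comm, Complex.mul_conj, Complex.normSq_eq_norm_sq]
    push_cast
    ring
  have hss : star (s : ℂ) = s := by rw [RCLike.star_def, Complex.conj_ofReal]
  -- Since `s² = ‖c‖`, conjugation by `diag(s, c̄ / s)` multiplies both diagonal blocks by `‖c‖` and
  -- the corner by `c`, phase included.
  obtain ⟨X, hX⟩ := exists_sandwich_block_eq.{u} n n (s : ℂ) (star c / s)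
  have h' := sandwich_mem_lambdaCone O L X h
  rw [hX] at h'
  have e1 : star (s : ℂ) * s = (‖c‖ : ℂ) := by rw [hss, hs]
  have e2 : star (star c / (s : ℂ)) * s = c := by
    rw [star_div₀, star_star, hss, div_mul_cancel₀ _ hs0]
  have e3 : star (s : ℂ) * (star c / s) = star c := by rw [hss, mul_div_cancel₀ _ hs0]
  have e4 : star (star c / (s : ℂ)) * (star c / s) = (‖c‖ : ℂ) := by
    rw [star_div₀, star_star, hss, div_mul_div_comm, hs, mul_comm c, hcc,
      mul_div_cancel_right₀ _ (by exact_mod_cast hc0.ne')]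
  rw [e1, e2, e3, e4, ← tensorAdjoint_smul] at h'
  refine (bigLambdaNorm_le L O h').trans (max_le ?_ ?_)
  · refine (lambdaNorm_smul_le L _ hm hE1 _ _).trans ?_
    rw [Complex.norm_real, norm_norm]
    calc ‖c‖ * _ ≤ ‖c‖ * (bigLambdaNorm L O z + ε / ‖c‖) := by gcongr
      _ = _ := by field_simp
  · refine (lambdaNorm_smul_le L _ hm hE1 _ _).trans ?_
    rw [Complex.norm_real, norm_norm]
    calc ‖c‖ * _ ≤ ‖c‖ * (bigLambdaNorm L O z + ε / ‖c‖) := by gcongr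
      _ = _ := by field_simp

theorem bigLambdaNorm_add_le (hm : 0 < m) (hO : ∀ t, (O t).IsMatrixRegular)
    (hE1 : L.E1) (hE2 : L.E2) (hO1 : L.O1) (hO2 : L.O2)
    (z y : Matrix (Fin n) (Fin n) (⨂[ℂ] t, V t)) :
    bigLambdaNorm L O (z + y) ≤ bigLambdaNorm L O z + bigLambdaNorm L O y := by
  refine le_of_forall_pos_le_add fun ε hε => ?_
  obtain ⟨w, w', h, hw, hw'⟩ := exists_lt_of_bigLambdaNorm_lt L O hm hO hE1 hE2 hO1 hO2
    (show bigLambdaNorm L O z < bigLambdaNorm L O z + ε / 2 by linarith)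
  obtain ⟨x, x', h', hx, hx'⟩ := exists_lt_of_bigLambdaNorm_lt L O hm hO hE1 hE2 hO1 hO2
    (show bigLambdaNorm L O y < bigLambdaNorm L O y + ε / 2 by linarith)
  have hadd := add_mem_lambdaCone O L hE2 h h'
  rw [← block_add, ← tensorAdjoint_add] at hadd
  refine (bigLambdaNorm_le L O hadd).trans (max_le ?_ ?_)
  · refine (lambdaNorm_add_le L _ hm hE1 hE2 _ _).trans ?_
    linarith
  · refine (lambdaNorm_add_le L _ hm hE1 hE2 _ _).trans ?_
    linarith

/-- Small `w, w'` dominate `z` in a positive block matrix. A product functional carries this to a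
positive semidefinite scalar matrix with small diagonal blocks, whose off-diagonal entries must be
small too. -/
theorem eq_zero_of_bigLambdaNorm_eq_zero (hm : 0 < m) (hO : ∀ t, (O t).IsMatrixRegular)
    (hE1 : L.E1) (hE2 : L.E2) (hE3 : L.E3) (hO1 : L.O1) (hO2 : L.O2) (hO3 : L.O3)
    {z : Matrix (Fin n) (Fin n) (⨂[ℂ] t, V t)} (hz : bigLambdaNorm L O z = 0) : z = 0 := by
  refine eq_zero_of_map_productFunctional_eq_zero O hO fun φ hφ => ?_
  obtain ⟨K, hK, hKu⟩ := exists_norm_map_productFunctional_le L O hm hE1 hE3 hφ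
  ext i j
  rw [Matrix.zero_apply, ← norm_le_zero_iff]
  refine le_of_forall_pos_le_add fun ε hε => ?_
  obtain ⟨w, w', h, hw, hw'⟩ := exists_lt_of_bigLambdaNorm_lt L O hm hO hE1 hE2 hO1 hO2
    (show bigLambdaNorm L O z < ε / (K + 1) by rw [hz]; positivity)
  have hpos := posSemidef_map_productFunctional L O hO3 hφ h
  have hblock : (block w z (tensorAdjoint z) w').map (productFunctional φ) =
      block (w.map (productFunctional φ)) (z.map (productFunctional φ))
        ((tensorAdjoint z).map (productFunctional φ)) (w'.map (productFunctional φ)) := by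
    rw [block, block, ← Matrix.fromBlocks_map]
    rfl
  rw [hblock] at hpos
  have hb : ∀ x : Matrix (Fin n) (Fin n) (⨂[ℂ] t, V t),
      lambdaNorm L (fun t => (O t).toOperatorSpace) x < ε / (K + 1) →
      ‖x.map (productFunctional φ)‖ ≤ ε := by
    intro x hx
    calc _ ≤ K * (ε / (K + 1)) := (hKu n x).trans (by gcongr)
      _ ≤ ε := by
        rw [mul_div_assoc', div_le_iff₀ (by positivity)]
        nlinarith
  rw [zero_add]
  refine le_of_sq_le_sq ?_ hε.le
  refine (norm_entry_sq_le_of_posSemidef_block hpos i j).trans ?_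
  rw [sq]
  exact mul_le_mul (hb w hw) (hb w' hw') (norm_nonneg _) hε.le

theorem isNorm_bigLambdaNorm (hm : 0 < m) (hO : ∀ t, (O t).IsMatrixRegular)
    (hE1 : L.E1) (hE2 : L.E2) (hE3 : L.E3) (hO1 : L.O1) (hO2 : L.O2) (hO3 : L.O3) :
    IsNorm (bigLambdaNorm L O : Matrix (Fin n) (Fin n) (⨂[ℂ] t, V t) → ℝ) where
  nonneg := bigLambdaNorm_nonneg L O
  eq_zero_iff z := by
    refine ⟨eq_zero_of_bigLambdaNorm_eq_zero L O hm hO hE1 hE2 hE3 hO1 hO2 hO3, ?_⟩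
    rintro rfl
    refine le_antisymm ?_ (bigLambdaNorm_nonneg L O _)
    simpa using bigLambdaNorm_smul_le L O hm hO hE1 hE2 hO1 hO2 0
      (0 : Matrix (Fin n) (Fin n) (⨂[ℂ] t, V t))
  smul c z := by
    refine le_antisymm (bigLambdaNorm_smul_le L O hm hO hE1 hE2 hO1 hO2 c z) ?_
    rcases eq_or_ne c 0 with rfl | hc
    · rw [norm_zero, zero_mul]
      exact bigLambdaNorm_nonneg L O _
    -- The reverse inequality is the one already proved, applied to `c⁻¹` and `c • z`.
    have h := bigLambdaNorm_smul_le L O hm hO hE1 hE2 hO1 hO2 c⁻¹ (c • z)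
    rw [smul_smul, inv_mul_cancel₀ hc, one_smul, norm_inv, le_inv_mul_iff₀ (norm_pos_iff.2 hc)] at h
    exact h
  add_le := bigLambdaNorm_add_le L O hm hO hE1 hE2 hO1 hO2

end BigLambdaNorm

end LambdaTensor

theorem mainTheorem10 {m : ℕ} (hm : 0 < m) {V : Fin m → Type*}
    [∀ t, AddCommGroup (V t)] [∀ t, Module ℂ (V t)]
    [∀ t, StarAddMonoid (V t)] [∀ t, StarModule ℂ (V t)]
    (O : ∀ t, LambdaTensor.MatrixOrderedOperatorSpace (V t))
    (hO : ∀ t, (O t).IsMatrixRegular)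
    (L : LambdaTensor.MatrixProducts m)
    (hE1 : L.E1) (hE2 : L.E2) (hE3 : L.E3) (hO1 : L.O1) (hO2 : L.O2) (hO3 : L.O3)
    (n : ℕ) (hn : 0 < n) :
    ((∀ u ∈ LambdaTensor.lambdaCone L O n, LambdaTensor.tensorAdjoint u = u) ∧
      LambdaTensor.IsProperCone (LambdaTensor.lambdaCone L O n)) ∧
    (∀ z : Matrix (Fin n) (Fin n) (⨂[ℂ] t, V t),
      ∃ u₁ ∈ LambdaTensor.lambdaCone L O n, ∃ u₂ ∈ LambdaTensor.lambdaCone L O n,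
        LambdaTensor.block u₁ z (LambdaTensor.tensorAdjoint z) u₂ ∈
          LambdaTensor.lambdaCone L O (n + n)) ∧
    LambdaTensor.IsNorm
      (LambdaTensor.bigLambdaNorm L O : Matrix (Fin n) (Fin n) (⨂[ℂ] t, V t) → ℝ) := by
  exact ⟨⟨fun _ hu => LambdaTensor.tensorAdjoint_eq_of_mem_lambdaCone O L hO1 hu,
    LambdaTensor.isProperCone_lambdaCone L O hO hE2 hO3 n⟩,
    LambdaTensor.exists_block_mem_lambdaCone O L hm hO hE1 hE2 hO1 hO2,
    LambdaTensor.isNorm_bigLambdaNorm L O hm hO hE1 hE2 hE3 hO1 hO2 hO3⟩
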